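/- Let $n_s,n_r,n_d\ge 1$ be integers, $q=\min(n_d,n_r)$, $p=\max(n_d,n_r)$, let $\alpha>0$, $\rho\ge 0$ and $a=\alpha/(n_r(1+\rho))$. Let $\mathbf H_2$ be a random $n_d\times n_r$ matrix whose entries are i.i.d. zero-mean circularly symmetric complex Gaussian of unit variance, let $\lambda_1\le\dots\le\lambda_q$ be its singular values, and put $$\mathbf L=\mathrm{diag}\Big(\frac{\lambda_i^2}{1+a\lambda_i^2}\Big)_{i=1}^q .$$ Let $\tilde{\mathbf H}_1$ be a random $q\times n_s$ matrix, independent of $\mathbf L$, whose entries are i.i.d. zero-mean circularly symmetric complex Gaussian of unit variance. Then $\det\big(\mathbf I_{n_s}+\frac{\rho a}{n_s}\tilde{\mathbf H}_1^\dagger\mathbf L\tilde{\mathbf H}_1\big)$ is integrable and $$E\Big\{\det\Big(\mathbf I_{n_s}+\frac{\rho a}{n_s}\tilde{\mathbf H}_1^\dagger\mathbf L\tilde{\mathbf H}_1\Big)\Big\}=\mathcal K\,\det(\bar{\boldsymbol\Xi}),\qquad \mathcal K=\Big(\prod_{i=1}^q\Gamma(q-i+1)\Gamma(p-i+1)\Big)^{-1},$$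 where $\bar{\boldsymbol\Xi}$ is the $q\times q$ matrix with entries ($1\le m,n\le q$) $$\{\bar{\boldsymbol\Xi}\}_{m,n}=\begin{cases}a^{1-\tau}\,\vartheta_{\tau-1}(a), & n\le q-n_s,\\[2pt] a^{1-\tau}\Big(\vartheta_{\tau-1}(a)+\dfrac{\rho}{n_s}(n_s-q+n)\,\vartheta_\tau(a)\Big), & n>q-n_s,\end{cases}$$ with $\tau=p-q+m+n$ and $\vartheta_\tau(a)=\Gamma(\tau)\,U(\tau,p+q,1/a)$. Here $U$ is the confluent hypergeometric function of the second kind, $U(b,c,z)=\frac1{\Gamma(b)}\int_0^\infty e^{-zt}t^{b-1}(1+t)^{c-b-1}\,dt$ for $b,z>0$. -/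

import Mathlib

open MeasureTheory ProbabilityTheory
open scoped Matrix

/-- The law of a zero-mean circularly symmetric complex Gaussian variable of unit variance: real
and imaginary part are independent real Gaussians of mean `0` and variance `1 / 2`. -/
noncomputable def stdComplexGaussian : Measure ℂ :=
  ((gaussianReal 0 (1 / 2)).prod (gaussianReal 0 (1 / 2))).map
    (fun z : ℝ × ℝ => (⟨z.1, z.2⟩ : ℂ))

/-- The entries of the random matrix `H` are independent and identically distributed zero-mean
circularly symmetric complex Gaussian variables of unit variance. -/
structure IsStdComplexGaussianMatrix {Ω : Type*} [MeasurableSpace Ω] {r c : ℕ}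
    (H : Ω → Matrix (Fin r) (Fin c) ℂ) (μ : Measure Ω) : Prop where
  hasLaw_entry : ∀ i j, HasLaw (fun ω => H ω i j) stdComplexGaussian μ
  iIndepFun_entry : iIndepFun (fun (ij : Fin r × Fin c) ω => H ω ij.1 ij.2) μ

/-- The `i`-th of the `min r c` singular values `λ₁ ≤ ⋯ ≤ λ_{min r c}` of an `r × c` complex
matrix, in increasing order (the sequence `LinearMap.singularValues` is decreasing). -/
noncomputable def incSingularValue {r c : ℕ} (H : Matrix (Fin r) (Fin c) ℂ)
    (i : Fin (min r c)) : ℝ :=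
  (Matrix.toEuclideanLin H).singularValues (i.rev : ℕ)

/-- `βᵢ = λᵢ² / (1 + a λᵢ²)`, where the `λᵢ` are the singular values of `H`. -/
noncomputable def betaVal (a : ℝ) {r c : ℕ} (H : Matrix (Fin r) (Fin c) ℂ)
    (i : Fin (min r c)) : ℝ :=
  incSingularValue H i ^ 2 / (1 + a * incSingularValue H i ^ 2)

/-- The diagonal matrix `L = diag (λᵢ² / (1 + a λᵢ²))`, of size `min r c`. -/
noncomputable def matrixL (a : ℝ) {r c : ℕ} (H : Matrix (Fin r) (Fin c) ℂ) :
    Matrix (Fin (min r c)) (Fin (min r c)) ℂ :=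
  Matrix.diagonal (fun i => (betaVal a H i : ℂ))

/-- The confluent hypergeometric function of the second kind, for real parameters `α > 0`, `γ`
and real argument `z > 0`:
`U(α, γ, z) = (1 / Γ(α)) ∫₀^∞ e^{-z t} t^{α - 1} (1 + t)^{γ - α - 1} dt`. -/
noncomputable def tricomiU (α γ z : ℝ) : ℝ :=
  (Real.Gamma α)⁻¹ *
    ∫ t in Set.Ioi (0 : ℝ), Real.exp (-(z * t)) * t ^ (α - 1) * (1 + t) ^ (γ - α - 1)

/-- `ϑ_τ(a) = Γ(τ) U(τ, p + q, 1 / a)`. -/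
noncomputable def vartheta (p q : ℕ) (τ a : ℝ) : ℝ :=
  Real.Gamma τ * tricomiU τ ((p : ℝ) + q) (1 / a)

/-- `K = (∏_{i = 1}^q Γ(q - i + 1) Γ(p - i + 1))⁻¹`. -/
noncomputable def constK (p q : ℕ) : ℝ :=
  (∏ i ∈ Finset.Icc 1 q,
    Real.Gamma ((q : ℝ) - i + 1) * Real.Gamma ((p : ℝ) - i + 1))⁻¹

/-- The entry of `Ξ̄` in row `m` and column `n`, with rows and columns numbered from `1`. -/
noncomputable def xiBarEntry (p q ns : ℕ) (ρ a : ℝ) (m n : ℕ) : ℝ :=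
  let τ : ℝ := (p : ℝ) - q + m + n
  if (n : ℤ) ≤ (q : ℤ) - ns then
    a ^ (1 - τ) * vartheta p q (τ - 1) a
  else
    a ^ (1 - τ) *
      (vartheta p q (τ - 1) a + ρ / ns * ((ns : ℝ) - q + n) * vartheta p q τ a)

/-- The `q × q` matrix `Ξ̄`; the index `i : Fin q` stands for the row or column `i + 1`. -/
noncomputable def xiBar (p q ns : ℕ) (ρ a : ℝ) : Matrix (Fin q) (Fin q) ℝ :=
  Matrix.of fun i j => xiBarEntry p q ns ρ a ((i : ℕ) + 1) ((j : ℕ) + 1)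

/-!
The mean determinant is computed without the joint density of the singular values. Throughout, `q
= min n_d n_r`, `p = max n_d n_r`, `W` is the `q × q` Wishart matrix `H₂ H₂ᴴ` (or its counterpart
for the transpose of `H₂`), a sum of `p` independent terms `h hᴴ`, and `βᵢ` are the diagonal
entries of `L`.

Averages of `det (B + ∑ₗ hₗ kₗᵀ)` over independent rank one terms are governed by one principle
(`integral_prod_mul_det_add_sum_vecMulVec`): by the matrix determinant lemma and Jacobi's formula,
one term with mean `M` acts on the polynomial `P(t) = det (B + t M)` as `1 + d/dt`, so that `n`
terms give `∑ₖ n (n - 1) ⋯ (n - k + 1) Pₖ`.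

Expand `det (1 + c H̃₁ᴴ L H̃₁)` in the `βᵢ`. The coefficient of `∏_{i ∈ S} βᵢ` is `c ^ |S|` times
a principal minor of `H̃₁ H̃₁ᴴ`, whose mean is `n_s (n_s - 1) ⋯ (n_s - |S| + 1)` by the principle.
By independence the mean determinant is `∑ₖ cᵏ n_s (n_s - 1) ⋯ (n_s - k + 1) gₖ`, where `gₖ` is
the mean of the `k`-th elementary symmetric function of the `βᵢ`
(`integrable_and_integral_det_one_add`).

The generating function of the `gₖ` is the mean of `∏ᵢ (1 + x βᵢ) = det (1 + (a + x) W) / det (1 +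
a W)`. The reciprocal of the denominator is the Gaussian average of `exp (-a uᴴ W u)` over a
vector `u`, a product of weights on the columns, so the principle applies for fixed `u`; only
radial averages over `u` are left (`integral_det_ratio`). The result is an explicit polynomial
`G(y)`, `y = a + x`, of degree `q`.

The polynomial `sᵖ G(-1/s)` turns out to be orthogonal to all polynomials of degree below `q` for
the weight `e⁻ˢ / (1 + a s)` (`integral_pow_mul_ratioPoly_eq_zero`). The substitution `x = as` in
the integrals for `U` turns the entries of `Ξ̄` into moments of `s / (1 + a s)` under the weight
`s ^ (p - q) e⁻ˢ (1 + a s) ^ (2q - 2)`: column `j` of `Ξ̄` is `vⱼ + bⱼ vⱼ₊₁`, where `v_t` is the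
column of the moments of order `i + t` (`xiBar_eq`), and orthogonality becomes the linear relation
`∑ₖ (-1)ᵏ gₖ v_{q-k} = 0` (`sum_neg_one_pow_mul_betaMoment`). Hence `det Ξ̄` is the Hankel
determinant `det (v₀, …, v_{q-1}) = 𝒦⁻¹` times the sum found above (`det_shifted_columns`,
`constK_mul_det_xiBar`).

The singular values enter integrals through their symmetric functions. That each of them is a
measurable function of the matrix follows since an injective measurable map of standard Borel
spaces has a measurable inverse (`measurable_sq_incSingularValue`).
-/

/-! ### Determinants under rank one perturbations -/

namespace Matrix

open Polynomial

variable {m R : Type*} [Fintype m] [DecidableEq m] [CommRing R]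

theorem det_updateRow_eq_sum_adjugate (A : Matrix m m R) (i : m) (v : m → R) :
    (A.updateRow i v).det = ∑ j, v j * A.adjugate j i := by
  have h := congrFun (cramer_eq_adjugate_mulVec Aᵀ v) i
  rw [cramer_transpose_apply, ← adjugate_transpose] at h
  rw [h]
  simp [mulVec, dotProduct, mul_comm]

/-- The matrix determinant lemma in adjugate form, without invertibility of `A`. -/
theorem det_add_vecMulVec (A : Matrix m m R) (u v : m → R) :
    (A + vecMulVec u v).det = A.det + ∑ i, ∑ j, u i * v j * A.adjugate j i := by
  -- add the rank one matrix row by row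
  have key : ∀ s : Finset m, (A + of fun i j => if i ∈ s then u i * v j else 0).det =
      A.det + ∑ i ∈ s, u i * (A.updateRow i v).det := by
    intro s
    induction s using Finset.induction_on with
    | empty =>
      have h0 : (A + of fun i j => if i ∈ (∅ : Finset m) then u i * v j else 0) = A := by
        ext i j; simp
      rw [h0, Finset.sum_empty, add_zero]
    | insert k s hk ih =>
      set As : Matrix m m R := A + of fun i j => if i ∈ s then u i * v j else 0 with hAs
      have h1 : (A + of fun i j => if i ∈ insert k s then u i * v j else 0) =
          As.updateRow k (As k + u k • v) := by
        ext i j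
        by_cases hik : i = k
        · subst hik; simp [hAs, hk]
        · simp [hAs, hik]
      have h2 : (As.updateRow k v).det = (A.updateRow k v).det := by
        -- the row `v` in position `k` clears the multiples of `v` in the other rows
        refine det_eq_of_forall_row_eq_smul_add_const (fun i => if i ∈ s then u i else 0) k
          (by simp [hk]) fun i j => ?_
        by_cases hik : i = k
        · subst hik; simp [hk]
        · by_cases his : i ∈ s <;> simp [hAs, hik, his]
      rw [h1, det_updateRow_add, det_updateRow_smul, updateRow_eq_self, ih, h2,
        Finset.sum_insert hk]
      ring
  have h := key Finset.univ
  have h0 : (A + of fun i j => if i ∈ Finset.univ then u i * v j else 0) =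
      A + vecMulVec u v := by
    ext i j; simp [vecMulVec_apply]
  rw [h0] at h
  simp_rw [h, det_updateRow_eq_sum_adjugate, Finset.mul_sum, mul_assoc]

/-- Jacobi's formula for a matrix of polynomials. -/
theorem derivative_det (A : Matrix m m R[X]) :
    derivative A.det = ∑ i, ∑ j, derivative (A i j) * A.adjugate j i := by
  simp_rw [← det_updateRow_eq_sum_adjugate A _ (fun j => derivative (A _ j))]
  simp_rw [← det_transpose (updateRow _ _ _)]
  rw [← det_transpose A, det_apply']
  simp_rw [det_apply', derivative_sum]
  rw [Finset.sum_comm]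
  refine Finset.sum_congr rfl fun σ _ => ?_
  rw [← Finset.mul_sum, show ((σ.sign : ℤ) : R[X]) = C ((σ.sign : ℤ) : R) by simp,
    derivative_C_mul]
  congr 1
  simp only [transpose_apply]
  rw [Finset.prod_eq_multiset_prod, derivative_prod, ← Finset.sum_eq_multiset_sum]
  refine Finset.sum_congr rfl fun i _ => ?_
  rw [← Finset.erase_val, ← Finset.prod_eq_multiset_prod,
    ← Finset.prod_erase_mul _ _ (Finset.mem_univ i)]
  congr 1
  · exact Finset.prod_congr rfl fun k hk => by simp [Finset.ne_of_mem_erase hk]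
  · simp

end Matrix

/-! ### Averages of determinants of sums of random rank one matrices -/

section RandomRankOne

open Matrix Polynomial

/-- The linear functional `P ↦ ∑ₖ n (n - 1) ⋯ (n - k + 1) Pₖ` on polynomials, that is,
`P ↦ ((1 + d/dt)ⁿ P)(0)`. -/
noncomputable def descCoeffSum (n : ℕ) : ℂ[X] →ₗ[ℂ] ℂ :=
  ∑ k ∈ Finset.range (n + 1), (n.descFactorial k : ℂ) • lcoeff ℂ k

theorem descCoeffSum_apply (n : ℕ) (P : ℂ[X]) :
    descCoeffSum n P = ∑ k ∈ Finset.range (n + 1), (n.descFactorial k : ℂ) * P.coeff k := by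
  simp [descCoeffSum]

/-- `1 + d/dt` raises the index of the functional by one. -/
theorem descCoeffSum_add_derivative (n : ℕ) (P : ℂ[X]) :
    descCoeffSum n (P + derivative P) = descCoeffSum (n + 1) P := by
  have h : ∀ k, ((n + 1).descFactorial (k + 1) : ℂ) =
      n.descFactorial (k + 1) + (k + 1) * n.descFactorial k := by
    intro k
    rw [Nat.succ_descFactorial_succ, Nat.descFactorial_succ]
    rcases le_or_gt k n with hk | hk
    · push_cast [Nat.cast_sub hk]; ring
    · simp [Nat.descFactorial_eq_zero_iff_lt.2 hk]
  rw [descCoeffSum_apply, descCoeffSum_apply, Finset.sum_range_succ' _ (n + 1)]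
  simp only [coeff_add, coeff_derivative, mul_add (Nat.cast _), Finset.sum_add_distrib, h, add_mul]
  have h1 : ∑ k ∈ Finset.range (n + 1), (n.descFactorial k : ℂ) * P.coeff k =
      ∑ k ∈ Finset.range (n + 1), (n.descFactorial (k + 1) : ℂ) * P.coeff (k + 1) +
        P.coeff 0 := by
    have := Finset.sum_range_succ' (fun k => (n.descFactorial k : ℂ) * P.coeff k) (n + 1)
    rw [Finset.sum_range_succ] at this
    simpa using this
  rw [h1]
  simp only [Nat.descFactorial_zero, Nat.cast_one, one_mul]
  rw [← Finset.sum_add_distrib, add_right_comm, ← Finset.sum_add_distrib, ← Finset.sum_add_distrib]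
  congr 1
  exact Finset.sum_congr rfl fun x _ => by ring

/-- Integral over `n + 1` independent points as an iterated integral over one and `n` points. -/
theorem integral_pi_fin_succ {E : Type*} [MeasurableSpace E] (ν : Measure E) [SigmaFinite ν]
    {n : ℕ} {f : (Fin (n + 1) → E) → ℂ}
    (hf : Integrable f (Measure.pi fun _ => ν)) :
    ∫ x, f x ∂(Measure.pi fun _ => ν) =
      ∫ x₀, ∫ x, f (Fin.cons x₀ x) ∂(Measure.pi fun _ => ν) ∂ν := by
  have e := (measurePreserving_piFinSuccAbove (fun _ : Fin (n + 1) => ν) 0).symm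
  rw [← e.integral_comp' f, integral_prod]
  · simp [MeasurableEquiv.piFinSuccAbove_symm_apply, Fin.insertNthEquiv]
  · exact e.integrable_comp_of_integrable hf

theorem integrable_pi_fin_succ_iff {E : Type*} [MeasurableSpace E] (ν : Measure E) [SigmaFinite ν]
    {n : ℕ} {f : (Fin (n + 1) → E) → ℂ} :
    Integrable f (Measure.pi fun _ => ν) ↔
      Integrable (fun z : E × (Fin n → E) => f (Fin.cons z.1 z.2))
        (ν.prod (Measure.pi fun _ => ν)) := by
  have e := (measurePreserving_piFinSuccAbove (fun _ : Fin (n + 1) => ν) 0).symm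
  rw [← e.integrable_comp_emb (MeasurableEquiv.measurableEmbedding _)]
  simp [MeasurableEquiv.piFinSuccAbove_symm_apply, Fin.insertNthEquiv, Function.comp_def]

variable {E : Type*} [MeasurableSpace E] {ν : Measure E} [SigmaFinite ν]
  {m : Type*} [Fintype m] [DecidableEq m] {w : E → ℂ}

/-- Integrability by induction on the number of rank one terms: the determinant is affine in the
first one, with cofactors of the remaining sum as coefficients, and a cofactor is again a
determinant of the same shape. -/
theorem integrable_prod_mul_det_add_sum_vecMulVec (hw : Integrable w ν) (n : ℕ)
    (h k : E → m → ℂ) (hint : ∀ i j, Integrable (fun x => w x * (h x i * k x j)) ν)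
    (B : Matrix m m ℂ) :
    Integrable (fun x : Fin n → E =>
      (∏ l, w (x l)) * (B + ∑ l, vecMulVec (h (x l)) (k (x l))).det)
      (Measure.pi fun _ => ν) := by
  induction n generalizing h B with
  | zero =>
    rw [Measure.pi_of_empty]; simp
  | succ n ih =>
    rw [integrable_pi_fin_succ_iff]
    -- a cofactor is the determinant with row `j` of `B` replaced and entry `j` of each
    -- `h` set to `0`
    have hA : ∀ x : Fin n → E, ∀ i j,
        (B + ∑ l, vecMulVec (h (x l)) (k (x l))).adjugate i j =
        (B.updateRow j (Pi.single i 1) +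
          ∑ l, vecMulVec (Function.update (h (x l)) j 0) (k (x l))).det := by
      intro x i j
      rw [adjugate_apply]
      congr 1
      ext a b
      by_cases ha : a = j
      · subst ha; simp [Matrix.sum_apply, vecMulVec_apply]
      · simp [Matrix.sum_apply, vecMulVec_apply, ha]
    have hadj : ∀ i j, Integrable (fun x : Fin n → E => (∏ l, w (x l)) *
        (B + ∑ l, vecMulVec (h (x l)) (k (x l))).adjugate i j) (Measure.pi fun _ => ν) := by
      intro i j
      simp_rw [hA]
      refine ih (fun x => Function.update (h x) j 0) (fun a b => ?_) _
      by_cases ha : a = j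
      · subst ha; simp
      · simpa [ha] using hint a b
    have hsum := ((hw.mul_prod (ih h hint B)).add
      (integrable_finsetSum Finset.univ fun i _ => integrable_finsetSum Finset.univ fun j _ =>
        (hint i j).mul_prod (hadj j i)))
    refine hsum.congr (Filter.Eventually.of_forall fun z => ?_)
    simp only [Pi.add_apply, Fin.prod_univ_succ, Fin.sum_univ_succ, Fin.cons_zero, Fin.cons_succ]
    rw [add_comm (vecMulVec _ _), ← add_assoc, det_add_vecMulVec, mul_add, Finset.mul_sum]
    congr 1
    · ring
    · refine Finset.sum_congr rfl fun i _ => ?_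
      rw [Finset.mul_sum]
      exact Finset.sum_congr rfl fun j _ => by ring

/-- Averaging `det (B + ∑ₗ hₗ kₗᵀ)` over independent rank one terms with weight `w`. One term acts
on the polynomial `P t = det (B + t M)` as `P ↦ P + P'`, by the matrix determinant lemma and
Jacobi's formula. -/
theorem integral_prod_mul_det_add_sum_vecMulVec (hw : Integrable w ν) {Z : ℂ}
    (hZ : ∫ x, w x ∂ν = Z) (h k : E → m → ℂ) (M : Matrix m m ℂ)
    (hint : ∀ i j, Integrable (fun x => w x * (h x i * k x j)) ν)
    (hM : ∀ i j, ∫ x, w x * (h x i * k x j) ∂ν = Z * M i j) (n : ℕ) (B : Matrix m m ℂ) :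
    ∫ x : Fin n → E, (∏ l, w (x l)) * (B + ∑ l, vecMulVec (h (x l)) (k (x l))).det
      ∂(Measure.pi fun _ => ν) =
      Z ^ n * descCoeffSum n (B.map C + (X : ℂ[X]) • M.map C).det := by
  induction n generalizing B with
  | zero =>
    have h0 : (B.map C + (X : ℂ[X]) • M.map C).det.eval 0 = B.det := by
      rw [← coe_evalRingHom, RingHom.map_det]
      congr 1
      ext i j
      simp
    rw [Measure.pi_of_empty]
    simp [descCoeffSum_apply, coeff_zero_eq_eval_zero, h0]
  | succ n ih =>
    rw [integral_pi_fin_succ _ (integrable_prod_mul_det_add_sum_vecMulVec hw _ h k hint B)]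
    simp only [Fin.prod_univ_succ, Fin.sum_univ_succ, Fin.cons_zero, Fin.cons_succ,
      ← add_assoc, mul_assoc, integral_const_mul, ih]
    set Bt : Matrix m m ℂ[X] := B.map C + (X : ℂ[X]) • M.map C with hBt
    have hdet : ∀ x : E, ((B + vecMulVec (h x) (k x)).map C + (X : ℂ[X]) • M.map C).det =
        Bt.det + ∑ i, ∑ j, C (h x i * k x j) * Bt.adjugate j i := by
      intro x
      have : (B + vecMulVec (h x) (k x)).map C + (X : ℂ[X]) • M.map C =
          Bt + vecMulVec (fun i => C (h x i)) (fun i => C (k x i)) := by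
        ext1 i j
        simp [hBt, vecMulVec_apply]; ring
      rw [this, det_add_vecMulVec]
      simp
    have hder : derivative Bt.det = ∑ i, ∑ j, C (M i j) * Bt.adjugate j i := by
      rw [derivative_det]; simp [hBt]
    have hlin : ∀ x : E, descCoeffSum n
        ((B + vecMulVec (h x) (k x)).map C + (X : ℂ[X]) • M.map C).det =
        descCoeffSum n Bt.det +
          ∑ i, ∑ j, (h x i * k x j) * descCoeffSum n (Bt.adjugate j i) := by
      intro x
      rw [hdet]
      simp only [map_add, map_sum, ← smul_eq_C_mul, map_smul, smul_eq_mul]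
    have hlin' : descCoeffSum n (Bt.det + derivative Bt.det) =
        descCoeffSum n Bt.det + ∑ i, ∑ j, M i j * descCoeffSum n (Bt.adjugate j i) := by
      rw [hder]
      simp only [map_add, map_sum, ← smul_eq_C_mul, map_smul, smul_eq_mul]
    have hterm : ∀ x : E, w x * (Z ^ n * (descCoeffSum n Bt.det +
          ∑ i, ∑ j, (h x i * k x j) * descCoeffSum n (Bt.adjugate j i))) =
        Z ^ n * (w x * descCoeffSum n Bt.det +
          ∑ i, ∑ j, (w x * (h x i * k x j)) * descCoeffSum n (Bt.adjugate j i)) := by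
      intro x
      rw [mul_left_comm, mul_add, Finset.mul_sum]
      simp only [Finset.mul_sum, mul_assoc]
    have hi : ∀ i j, Integrable (fun x => w x * (h x i * k x j) *
        descCoeffSum n (Bt.adjugate j i)) ν := fun i j => (hint i j).mul_const _
    simp only [hlin, hterm]
    rw [integral_const_mul, integral_add (hw.mul_const _)
      (integrable_finsetSum _ fun i _ => integrable_finsetSum _ fun j _ => hi i j),
      integral_mul_const, hZ, integral_finsetSum _ fun i _ => integrable_finsetSum _ fun j _ => hi i j,
      ← descCoeffSum_add_derivative, hlin', pow_succ, mul_assoc, mul_add Z, Finset.mul_sum]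
    congr 2
    refine Finset.sum_congr rfl fun i _ => ?_
    rw [integral_finsetSum _ fun j _ => hi i j, Finset.mul_sum]
    refine Finset.sum_congr rfl fun j _ => ?_
    rw [integral_mul_const, hM, mul_assoc]

end RandomRankOne

/-! ### The standard complex Gaussian law on the plane -/

section GaussianScalar

theorem measurable_complex_mk : Measurable (fun z : ℝ × ℝ => (⟨z.1, z.2⟩ : ℂ)) :=
  Complex.measurableEquivRealProd.symm.measurable

instance : IsProbabilityMeasure stdComplexGaussian :=
  Measure.isProbabilityMeasure_map measurable_complex_mk.aemeasurable

/-- An exponential weight turns the Gaussian of variance `1 / 2` into a multiple of the Gaussian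
of variance `v = 1 / (2 (1 + s))`. -/
theorem integral_exp_neg_mul_sq_mul_gaussianReal {s : ℝ} (hs : 0 ≤ s) {v : NNReal}
    (hv : (v : ℝ) = 1 / (2 * (1 + s))) (f : ℝ → ℝ) :
    ∫ x, Real.exp (-(s * x ^ 2)) * f x ∂(gaussianReal 0 (1 / 2)) =
      (√(1 + s))⁻¹ * ∫ x, f x ∂(gaussianReal 0 v) := by
  have h1 : (0 : ℝ) < 1 + s := by positivity
  have hv0 : v ≠ 0 := by
    intro h
    rw [h, NNReal.coe_zero] at hv
    have : (0 : ℝ) < 1 / (2 * (1 + s)) := by positivity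
    exact this.ne hv
  rw [integral_gaussianReal_eq_integral_smul (by norm_num),
    integral_gaussianReal_eq_integral_smul hv0, ← integral_const_mul]
  refine integral_congr_ae (Filter.Eventually.of_forall fun x => ?_)
  simp only [gaussianPDFReal, smul_eq_mul, hv]
  have e : Real.exp (-(x - 0) ^ 2 / (2 * (1 / (2 * (1 + s))))) =
      Real.exp (-(x - 0) ^ 2 / (2 * ((1 / 2 : NNReal) : ℝ))) * Real.exp (-(s * x ^ 2)) := by
    rw [← Real.exp_add]
    congr 1
    push_cast
    field_simp
    ring
  have e2 : √(2 * Real.pi * (1 / (2 * (1 + s)))) =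
      √(2 * Real.pi * ((1 / 2 : NNReal) : ℝ)) * (√(1 + s))⁻¹ := by
    rw [← Real.sqrt_inv, ← Real.sqrt_mul (by positivity)]
    congr 1
    push_cast
    field_simp
  rw [e, e2]
  have h3 := Real.sqrt_pos.2 h1
  field_simp

theorem integral_sq_gaussianReal_zero (v : NNReal) : ∫ x, x ^ 2 ∂(gaussianReal 0 v) = v := by
  have h := variance_fun_id_gaussianReal (μ := 0) (v := v)
  rwa [variance_of_integral_eq_zero (by fun_prop) integral_id_gaussianReal] at h

theorem integral_stdComplexGaussian_mul (f g : ℝ → ℝ) (hf : Measurable f) (hg : Measurable g) :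
    ∫ z : ℂ, ((f z.re : ℝ) : ℂ) * ((g z.im : ℝ) : ℂ) ∂stdComplexGaussian =
      ((∫ x, f x ∂gaussianReal 0 (1 / 2) : ℝ) : ℂ) *
        ((∫ x, g x ∂gaussianReal 0 (1 / 2) : ℝ) : ℂ) := by
  rw [stdComplexGaussian, integral_map measurable_complex_mk.aemeasurable
    (by fun_prop), integral_prod_mul (fun x => ((f x : ℝ) : ℂ)) (fun x => ((g x : ℝ) : ℂ)),
    integral_complex_ofReal, integral_complex_ofReal]

theorem integrable_stdComplexGaussian_norm_sq :
    Integrable (fun z : ℂ => ‖z‖ ^ 2) stdComplexGaussian := by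
  rw [stdComplexGaussian, integrable_map_measure (by fun_prop) measurable_complex_mk.aemeasurable]
  have h : Integrable (fun x : ℝ => x ^ 2) (gaussianReal 0 (1 / 2)) :=
    (memLp_id_gaussianReal 2).integrable_sq
  refine ((h.comp_fst _).add (h.comp_snd _)).congr (Filter.Eventually.of_forall fun z => ?_)
  simp [Complex.sq_norm, Complex.normSq_apply]
  ring

theorem memLp_two_stdComplexGaussian : MemLp (fun z : ℂ => z) 2 stdComplexGaussian :=
  (memLp_two_iff_integrable_sq_norm (by fun_prop)).2 integrable_stdComplexGaussian_norm_sq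

theorem integrable_exp_neg_mul_norm_sq_mul {s : ℝ} (hs : 0 ≤ s) {f : ℂ → ℂ}
    (hf : Integrable f stdComplexGaussian) :
    Integrable (fun z => (Real.exp (-(s * ‖z‖ ^ 2)) : ℂ) * f z) stdComplexGaussian := by
  refine hf.bdd_mul (c := 1) (by fun_prop) (Filter.Eventually.of_forall fun z => ?_)
  rw [Complex.norm_real, Real.norm_eq_abs, Real.abs_exp, Real.exp_le_one_iff]
  have : 0 ≤ s * ‖z‖ ^ 2 := by positivity
  linarith

/-- The moments `1`, `z`, `|z|²` of a standard complex Gaussian under the weight `exp (-s |z|²)`,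
which factors over the real and imaginary parts. -/
theorem integral_exp_neg_mul_norm_sq_stdComplexGaussian {s : ℝ} (hs : 0 ≤ s) :
    ∫ z, (Real.exp (-(s * ‖z‖ ^ 2)) : ℂ) ∂stdComplexGaussian = (1 + (s : ℂ))⁻¹ ∧
    ∫ z, (Real.exp (-(s * ‖z‖ ^ 2)) : ℂ) * z ∂stdComplexGaussian = 0 ∧
    ∫ z, (Real.exp (-(s * ‖z‖ ^ 2)) : ℂ) * (z * star z) ∂stdComplexGaussian =
      (1 + (s : ℂ))⁻¹ * (1 + (s : ℂ))⁻¹ := by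
  have h1 : (0 : ℝ) < 1 + s := by positivity
  have h1c : (1 + (s : ℂ)) ≠ 0 := by exact_mod_cast h1.ne'
  have hsq : (((√(1 + s))⁻¹ : ℝ) : ℂ) * (((√(1 + s))⁻¹ : ℝ) : ℂ) = (1 + (s : ℂ))⁻¹ := by
    rw [← Complex.ofReal_mul, ← mul_inv, Real.mul_self_sqrt h1.le]; push_cast; rfl
  -- in each coordinate the weighted law is a multiple of the Gaussian of this smaller variance
  obtain ⟨v, hv⟩ : ∃ v : NNReal, (v : ℝ) = 1 / (2 * (1 + s)) := ⟨⟨_, by positivity⟩, rfl⟩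
  have I0 := integral_exp_neg_mul_sq_mul_gaussianReal hs hv (fun _ => 1)
  have I1 := integral_exp_neg_mul_sq_mul_gaussianReal hs hv (fun x => x)
  have I2 := integral_exp_neg_mul_sq_mul_gaussianReal hs hv (fun x => x ^ 2)
  rw [integral_id_gaussianReal, mul_zero] at I1
  rw [integral_sq_gaussianReal_zero, hv] at I2
  simp only [mul_one, integral_const, probReal_univ, smul_eq_mul] at I0
  have hexp : ∀ z : ℂ, (Real.exp (-(s * ‖z‖ ^ 2)) : ℂ) =
      (Real.exp (-(s * z.re ^ 2)) : ℂ) * (Real.exp (-(s * z.im ^ 2)) : ℂ) := by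
    intro z
    rw [← Complex.ofReal_mul, ← Real.exp_add, Complex.sq_norm, Complex.normSq_apply]
    congr 2; ring
  have hint1 : Integrable (fun z : ℂ => z) stdComplexGaussian :=
    memLp_two_stdComplexGaussian.integrable (by norm_num)
  refine ⟨?_, ?_, ?_⟩
  · simp_rw [hexp]
    rw [integral_stdComplexGaussian_mul (fun x => Real.exp (-(s * x ^ 2)))
      (fun x => Real.exp (-(s * x ^ 2))) (by fun_prop) (by fun_prop), I0, hsq]
  · have e : ∀ z : ℂ, (Real.exp (-(s * ‖z‖ ^ 2)) : ℂ) * z =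
        (Real.exp (-(s * ‖z‖ ^ 2)) : ℂ) * (z.re : ℂ) +
          ((Real.exp (-(s * ‖z‖ ^ 2)) : ℂ) * (z.im : ℂ)) * Complex.I := by
      intro z
      rw [mul_assoc, ← mul_add, Complex.re_add_im]
    have hre : Integrable (fun z : ℂ => (z.re : ℂ)) stdComplexGaussian := hint1.re.ofReal
    have him : Integrable (fun z : ℂ => (z.im : ℂ)) stdComplexGaussian := hint1.im.ofReal
    simp_rw [e]
    rw [integral_add (integrable_exp_neg_mul_norm_sq_mul hs hre)
      ((integrable_exp_neg_mul_norm_sq_mul hs him).mul_const _), integral_mul_const]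
    have e1 : ∀ z : ℂ, (Real.exp (-(s * ‖z‖ ^ 2)) : ℂ) * (z.re : ℂ) =
        ((Real.exp (-(s * z.re ^ 2)) * z.re : ℝ) : ℂ) * (Real.exp (-(s * z.im ^ 2)) : ℂ) := by
      intro z; rw [hexp]; push_cast; ring
    have e2 : ∀ z : ℂ, (Real.exp (-(s * ‖z‖ ^ 2)) : ℂ) * (z.im : ℂ) =
        (Real.exp (-(s * z.re ^ 2)) : ℂ) * ((Real.exp (-(s * z.im ^ 2)) * z.im : ℝ) : ℂ) := by
      intro z; rw [hexp]; push_cast; ring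
    simp_rw [e1, e2]
    rw [integral_stdComplexGaussian_mul (fun x => Real.exp (-(s * x ^ 2)) * x)
      (fun x => Real.exp (-(s * x ^ 2))) (by fun_prop) (by fun_prop),
      integral_stdComplexGaussian_mul (fun x => Real.exp (-(s * x ^ 2)))
      (fun x => Real.exp (-(s * x ^ 2)) * x) (by fun_prop) (by fun_prop), I1]
    simp
  · have e : ∀ z : ℂ, (Real.exp (-(s * ‖z‖ ^ 2)) : ℂ) * (z * star z) =
        (Real.exp (-(s * ‖z‖ ^ 2)) : ℂ) * ((z.re ^ 2 : ℝ) : ℂ) +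
          ((Real.exp (-(s * ‖z‖ ^ 2)) : ℂ) * ((z.im ^ 2 : ℝ) : ℂ)) := by
      intro z
      rw [← mul_add, Complex.star_def, Complex.mul_conj, Complex.normSq_apply]
      push_cast; ring
    have hre : Integrable (fun z : ℂ => ((z.re ^ 2 : ℝ) : ℂ)) stdComplexGaussian :=
      (memLp_two_stdComplexGaussian.re.integrable_sq).ofReal
    have him : Integrable (fun z : ℂ => ((z.im ^ 2 : ℝ) : ℂ)) stdComplexGaussian :=
      (memLp_two_stdComplexGaussian.im.integrable_sq).ofReal
    simp_rw [e]
    rw [integral_add (integrable_exp_neg_mul_norm_sq_mul hs hre)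
      (integrable_exp_neg_mul_norm_sq_mul hs him)]
    have e1 : ∀ z : ℂ, (Real.exp (-(s * ‖z‖ ^ 2)) : ℂ) * ((z.re ^ 2 : ℝ) : ℂ) =
        ((Real.exp (-(s * z.re ^ 2)) * z.re ^ 2 : ℝ) : ℂ) *
          (Real.exp (-(s * z.im ^ 2)) : ℂ) := by
      intro z; rw [hexp]; push_cast; ring
    have e2 : ∀ z : ℂ, (Real.exp (-(s * ‖z‖ ^ 2)) : ℂ) * ((z.im ^ 2 : ℝ) : ℂ) =
        (Real.exp (-(s * z.re ^ 2)) : ℂ) *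
          ((Real.exp (-(s * z.im ^ 2)) * z.im ^ 2 : ℝ) : ℂ) := by
      intro z; rw [hexp]; push_cast; ring
    simp_rw [e1, e2]
    rw [integral_stdComplexGaussian_mul (fun x => Real.exp (-(s * x ^ 2)) * x ^ 2)
      (fun x => Real.exp (-(s * x ^ 2))) (by fun_prop) (by fun_prop),
      integral_stdComplexGaussian_mul (fun x => Real.exp (-(s * x ^ 2)))
      (fun x => Real.exp (-(s * x ^ 2)) * x ^ 2) (by fun_prop) (by fun_prop), I0, I2]
    rw [Complex.ofReal_mul, mul_right_comm, mul_left_comm, ← mul_assoc, hsq, mul_comm, ← mul_add]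
    push_cast
    field_simp
    ring

theorem charFun_stdComplexGaussian (t : ℂ) :
    charFun stdComplexGaussian t = Complex.exp (-(‖t‖ ^ 2 / 4 : ℝ)) := by
  rw [charFun_apply, stdComplexGaussian, integral_map measurable_complex_mk.aemeasurable
    (by fun_prop)]
  have e : ∀ x : ℝ × ℝ, Complex.exp (((inner ℝ (⟨x.1, x.2⟩ : ℂ) t : ℝ) : ℂ) * Complex.I) =
      Complex.exp ((t.re : ℂ) * x.1 * Complex.I) * Complex.exp ((t.im : ℂ) * x.2 * Complex.I) := by
    intro x
    rw [← Complex.exp_add, Complex.inner]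
    congr 1
    simp
    ring
  simp_rw [e]
  rw [integral_prod_mul (fun x : ℝ => Complex.exp ((t.re : ℂ) * x * Complex.I))
    (fun x : ℝ => Complex.exp ((t.im : ℂ) * x * Complex.I)), ← charFun_apply_real,
    ← charFun_apply_real, charFun_gaussianReal, charFun_gaussianReal, ← Complex.exp_add]
  congr 1
  rw [Complex.sq_norm, Complex.normSq_apply]
  push_cast
  ring

end GaussianScalar

/-! ### Standard complex Gaussian vectors -/

section GaussianVector

open Matrix
open scoped ComplexOrder

variable {ι : Type*} [Fintype ι]

theorem integrable_pi_mul_star (i j : ι) :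
    Integrable (fun h : ι → ℂ => h i * star (h j))
      (Measure.pi fun _ : ι => stdComplexGaussian) := by
  have h : ∀ i, MemLp (fun h : ι → ℂ => h i) 2 (Measure.pi fun _ : ι => stdComplexGaussian) :=
    fun i => memLp_two_stdComplexGaussian.comp_measurePreserving
      (measurePreserving_eval (fun _ : ι => stdComplexGaussian) i)
  exact (h i).integrable_mul (h j).star

theorem charFun_pi_stdComplexGaussian (t : EuclideanSpace ℂ ι) :
    charFun ((Measure.pi fun _ : ι => stdComplexGaussian).map (WithLp.toLp 2)) t =
      Complex.exp (-((star t.ofLp ⬝ᵥ t.ofLp).re / 4 : ℝ)) := by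
  rw [charFun_pi (μ := fun _ : ι => stdComplexGaussian) t]
  simp_rw [charFun_stdComplexGaussian]
  rw [← Complex.exp_sum]
  congr 1
  rw [dotProduct, Complex.re_sum, Finset.sum_div, Complex.ofReal_sum, Finset.sum_neg_distrib]
  congr 1
  refine Finset.sum_congr rfl fun i _ => ?_
  rw [Pi.star_apply, Complex.star_def, ← Complex.normSq_eq_conj_mul_self, Complex.ofReal_re,
    Complex.sq_norm]

theorem integral_diagonal_gaussian {d : ι → ℝ} (hd : ∀ i, 0 ≤ d i) :
    ∫ h : ι → ℂ, ∏ l, (Real.exp (-(d l * ‖h l‖ ^ 2)) : ℂ)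
      ∂(Measure.pi fun _ : ι => stdComplexGaussian) = ∏ l, (1 + (d l : ℂ))⁻¹ := by
  rw [integral_fintype_prod_eq_prod (fun l (z : ℂ) => (Real.exp (-(d l * ‖z‖ ^ 2)) : ℂ))]
  exact Finset.prod_congr rfl fun l _ =>
    (integral_exp_neg_mul_norm_sq_stdComplexGaussian (hd l)).1

variable [DecidableEq ι]

/-- Unitary invariance of the standard complex Gaussian vector, whose characteristic function
depends only on the norm. -/
theorem map_mulVec_pi_stdComplexGaussian {U : Matrix ι ι ℂ} (hU : U ∈ unitaryGroup ι ℂ) :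
    (Measure.pi fun _ : ι => stdComplexGaussian).map (U *ᵥ ·) =
      Measure.pi fun _ : ι => stdComplexGaussian := by
  have hmeas : Measurable (fun x : ι → ℂ => U *ᵥ x) := by fun_prop
  have := Measure.isProbabilityMeasure_map (μ := Measure.pi fun _ : ι => stdComplexGaussian)
    hmeas.aemeasurable
  rw [← charFun_eq_pi_iff]
  intro t
  have h1 : charFun (((Measure.pi fun _ : ι => stdComplexGaussian).map (U *ᵥ ·)).map
      (WithLp.toLp 2)) t = charFun ((Measure.pi fun _ : ι => stdComplexGaussian).map
      (WithLp.toLp 2)) (WithLp.toLp 2 (Uᴴ *ᵥ t.ofLp)) := by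
    rw [charFun_apply, charFun_apply, Measure.map_map (by fun_prop) hmeas,
      integral_map (by fun_prop) (by fun_prop), integral_map (by fun_prop) (by fun_prop)]
    refine integral_congr_ae (Filter.Eventually.of_forall fun x => ?_)
    have hin : ∀ y z : ι → ℂ, inner ℝ (WithLp.toLp 2 y : EuclideanSpace ℂ ι)
        (WithLp.toLp 2 z) = (star y ⬝ᵥ z).re := by
      intro y z
      rw [PiLp.inner_apply, dotProduct, Complex.re_sum]
      exact Finset.sum_congr rfl fun i _ => by simp [Complex.inner]; ring
    have key : inner ℝ (WithLp.toLp 2 (U *ᵥ x) : EuclideanSpace ℂ ι) t =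
        inner ℝ (WithLp.toLp 2 x : EuclideanSpace ℂ ι) (WithLp.toLp 2 (Uᴴ *ᵥ t.ofLp)) := by
      rw [← WithLp.toLp_ofLp 2 t, hin, hin, star_mulVec, ← dotProduct_mulVec]
    simp only [Function.comp_apply, key]
  rw [h1, charFun_pi_stdComplexGaussian, ← charFun_pi, charFun_pi_stdComplexGaussian]
  have : star (Uᴴ *ᵥ t.ofLp) ⬝ᵥ (Uᴴ *ᵥ t.ofLp) = star t.ofLp ⬝ᵥ t.ofLp := by
    rw [star_mulVec, conjTranspose_conjTranspose, ← dotProduct_mulVec, mulVec_mulVec,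
      ← star_eq_conjTranspose, mem_unitaryGroup_iff.1 hU, one_mulVec]
  rw [this]

/-- Second moments of the standard complex Gaussian vector under a diagonal Gaussian weight. -/
theorem integral_diagonal_gaussian_mul {d : ι → ℝ} (hd : ∀ i, 0 ≤ d i) (i j : ι) :
    ∫ h : ι → ℂ, (∏ l, (Real.exp (-(d l * ‖h l‖ ^ 2)) : ℂ)) * (h i * star (h j))
      ∂(Measure.pi fun _ : ι => stdComplexGaussian) =
      (∏ l, (1 + (d l : ℂ))⁻¹) * if i = j then (1 + (d i : ℂ))⁻¹ else 0 := by
  have e : ∀ h : ι → ℂ, (∏ l, (Real.exp (-(d l * ‖h l‖ ^ 2)) : ℂ)) * (h i * star (h j)) =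
      ∏ l, (Real.exp (-(d l * ‖h l‖ ^ 2)) : ℂ) *
        ((if l = i then h l else 1) * (if l = j then star (h l) else 1)) := by
    intro h
    rw [Finset.prod_mul_distrib, Finset.prod_mul_distrib, Finset.prod_ite_eq', Finset.prod_ite_eq']
    simp
  simp_rw [e]
  rw [integral_fintype_prod_eq_prod (fun l (z : ℂ) => (Real.exp (-(d l * ‖z‖ ^ 2)) : ℂ) *
        ((if l = i then z else 1) * (if l = j then star z else 1)))]
  by_cases hij : i = j
  · subst hij
    rw [if_pos rfl, ← Finset.prod_erase_mul _ _ (Finset.mem_univ i),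
      ← Finset.prod_erase_mul _ _ (Finset.mem_univ i), mul_assoc]
    congr 1
    · refine Finset.prod_congr rfl fun l hl => ?_
      simp only [if_neg (Finset.ne_of_mem_erase hl), mul_one]
      exact (integral_exp_neg_mul_norm_sq_stdComplexGaussian (hd l)).1
    · simpa using (integral_exp_neg_mul_norm_sq_stdComplexGaussian (hd i)).2.2
  · rw [if_neg hij, mul_zero]
    refine Finset.prod_eq_zero (Finset.mem_univ i) ?_
    simpa [hij] using (integral_exp_neg_mul_norm_sq_stdComplexGaussian (hd i)).2.1

/-- The Gaussian integral of `exp (-h†Ah)` and its second moments, for positive semidefinite `A`: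
unitary invariance reduces to a diagonal `A`. -/
theorem integral_exp_neg_quadratic {A : Matrix ι ι ℂ} (hA : A.PosSemidef) :
    (∫ h : ι → ℂ, (Real.exp (-(star h ⬝ᵥ A *ᵥ h).re) : ℂ)
      ∂(Measure.pi fun _ : ι => stdComplexGaussian) = (1 + A).det⁻¹) ∧
    ∀ i j, ∫ h : ι → ℂ, (Real.exp (-(star h ⬝ᵥ A *ᵥ h).re) : ℂ) * (h i * star (h j))
      ∂(Measure.pi fun _ : ι => stdComplexGaussian) = (1 + A).det⁻¹ * (1 + A)⁻¹ i j := by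
  set U : Matrix ι ι ℂ := ↑hA.isHermitian.eigenvectorUnitary with hU
  set d := hA.isHermitian.eigenvalues with hd
  have hUmem : U ∈ unitaryGroup ι ℂ := hA.isHermitian.eigenvectorUnitary.2
  have hUU : U * Uᴴ = 1 := mem_unitaryGroup_iff.1 hUmem
  have hUU' : Uᴴ * U = 1 := mem_unitaryGroup_iff'.1 hUmem
  have hd0 : ∀ i, 0 ≤ d i := hA.eigenvalues_nonneg
  have hd1 : ∀ i, (1 + (d i : ℂ)) ≠ 0 := fun i => by
    have : (0 : ℝ) < 1 + d i := by linarith [hd0 i]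
    exact_mod_cast this.ne'
  have hspec : A = U * diagonal (fun i => (d i : ℂ)) * Uᴴ := by
    have := hA.isHermitian.spectral_theorem
    rw [Unitary.conjStarAlgAut_apply] at this
    exact this
  have h1A : 1 + A = U * diagonal (fun i => 1 + (d i : ℂ)) * Uᴴ := by
    rw [← diagonal_add, diagonal_one, mul_add, add_mul, mul_one, hUU, ← hspec]
  have hdet : (1 + A).det⁻¹ = ∏ l, (1 + (d l : ℂ))⁻¹ := by
    rw [h1A, det_mul_right_comm, hUU, one_mul, det_diagonal, Finset.prod_inv_distrib]
  have hinv : (1 + A)⁻¹ = U * diagonal (fun i => (1 + (d i : ℂ))⁻¹) * Uᴴ := by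
    refine inv_eq_right_inv ?_
    rw [h1A]
    calc _ = U * diagonal (fun i => 1 + (d i : ℂ)) * (Uᴴ * U) *
          diagonal (fun i => (1 + (d i : ℂ))⁻¹) * Uᴴ := by simp only [Matrix.mul_assoc]
      _ = 1 := by
        rw [hUU', mul_one, Matrix.mul_assoc U, diagonal_mul_diagonal]
        simp only [mul_inv_cancel₀ (hd1 _), diagonal_one, mul_one, hUU]
  have hquad : ∀ g : ι → ℂ, (Real.exp (-(star (U *ᵥ g) ⬝ᵥ A *ᵥ (U *ᵥ g)).re) : ℂ) =
      ∏ l, (Real.exp (-(d l * ‖g l‖ ^ 2)) : ℂ) := by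
    intro g
    rw [← Complex.ofReal_prod, ← Real.exp_sum, star_mulVec, ← dotProduct_mulVec, mulVec_mulVec,
      mulVec_mulVec]
    have : Uᴴ * A * U = diagonal (fun i => (d i : ℂ)) := by
      rw [Matrix.mul_assoc, hspec, Matrix.mul_assoc, Matrix.mul_assoc, hUU', mul_one,
        ← Matrix.mul_assoc, hUU', one_mul]
    rw [this, dotProduct, Complex.re_sum, ← Finset.sum_neg_distrib]
    refine congrArg _ (congrArg _ (Finset.sum_congr rfl fun l _ => congrArg _ ?_))
    rw [mulVec_diagonal, Pi.star_apply, mul_left_comm, Complex.re_ofReal_mul, Complex.star_def,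
      ← Complex.normSq_eq_conj_mul_self, Complex.ofReal_re, Complex.sq_norm]
  have hsubst : ∀ F : (ι → ℂ) → ℂ, Measurable F →
      ∫ h, F h ∂(Measure.pi fun _ : ι => stdComplexGaussian) =
      ∫ g, F (U *ᵥ g) ∂(Measure.pi fun _ : ι => stdComplexGaussian) := by
    intro F hF
    conv_lhs => rw [← map_mulVec_pi_stdComplexGaussian hUmem]
    exact integral_map (by fun_prop) hF.aestronglyMeasurable
  have hmeas : Measurable (fun h : ι → ℂ => (Real.exp (-(star h ⬝ᵥ A *ᵥ h).re) : ℂ)) := by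
    unfold dotProduct mulVec dotProduct
    simp only [Pi.star_apply]
    fun_prop
  constructor
  · rw [hsubst _ hmeas, hdet]
    simp only [hquad]
    exact integral_diagonal_gaussian hd0
  · intro i j
    rw [hsubst (fun h => (Real.exp (-(star h ⬝ᵥ A *ᵥ h).re) : ℂ) * (h i * star (h j)))
      (hmeas.mul (by fun_prop)), hdet, hinv]
    simp only [hquad]
    have e : ∀ g : ι → ℂ, (∏ l, (Real.exp (-(d l * ‖g l‖ ^ 2)) : ℂ)) *
        ((U *ᵥ g) i * star ((U *ᵥ g) j)) =
        ∑ k, ∑ l, (U i k * star (U j l)) *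
          ((∏ l, (Real.exp (-(d l * ‖g l‖ ^ 2)) : ℂ)) * (g k * star (g l))) := by
      intro g
      simp only [mulVec, dotProduct, star_sum, star_mul']
      rw [Finset.sum_mul_sum, Finset.mul_sum]
      refine Finset.sum_congr rfl fun k _ => ?_
      rw [Finset.mul_sum]
      exact Finset.sum_congr rfl fun l _ => by ring
    have hint : ∀ k l, Integrable (fun g : ι → ℂ =>
        (∏ l, (Real.exp (-(d l * ‖g l‖ ^ 2)) : ℂ)) * (g k * star (g l)))
        (Measure.pi fun _ : ι => stdComplexGaussian) := by
      intro k l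
      refine (integrable_pi_mul_star k l).bdd_mul (c := 1)
        (Finset.measurable_prod _ fun l _ => by fun_prop).aestronglyMeasurable
        (Filter.Eventually.of_forall fun g => ?_)
      rw [← Complex.ofReal_prod, ← Real.exp_sum, Complex.norm_real, Real.norm_eq_abs,
        Real.abs_exp, Real.exp_le_one_iff]
      exact Finset.sum_nonpos fun l _ => by have := hd0 l; simp only [Left.neg_nonpos_iff]; positivity
    simp only [e]
    rw [integral_finsetSum _ fun k _ => integrable_finsetSum _ fun l _ =>
      (hint k l).const_mul _]
    simp_rw [integral_finsetSum Finset.univ fun l _ => (hint _ l).const_mul _,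
      integral_const_mul, integral_diagonal_gaussian_mul hd0]
    simp only [mul_ite, mul_zero, Finset.sum_ite_eq, Finset.mem_univ, if_true]
    rw [Matrix.mul_apply, Finset.mul_sum]
    refine Finset.sum_congr rfl fun k _ => ?_
    rw [mul_diagonal, conjTranspose_apply]
    ring

end GaussianVector

/-! ### The averaged ratio of characteristic determinants of a Wishart matrix -/

section GaussianRatio

open Matrix Polynomial
open scoped ComplexOrder

variable {ι : Type*} [Fintype ι]

/-- The Gaussian average of `(1 + a ‖u‖²)⁻ᵐ` over the standard complex Gaussian vector `u`. -/
noncomputable def gaussRadial (ι : Type*) [Fintype ι] (a : ℝ) (m : ℕ) : ℝ :=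
  ∫ u : ι → ℂ, ((1 + a * ∑ i, ‖u i‖ ^ 2) ^ m)⁻¹ ∂(Measure.pi fun _ : ι => stdComplexGaussian)

theorem star_dotProduct_vecMulVec_mulVec (u v : ι → ℂ) :
    star u ⬝ᵥ vecMulVec v (star v) *ᵥ u = ((‖star v ⬝ᵥ u‖ ^ 2 : ℝ) : ℂ) := by
  rw [vecMulVec_mulVec, dotProduct_smul, ← Complex.normSq_eq_norm_sq, ← Complex.mul_conj]
  have : star u ⬝ᵥ v = (starRingEnd ℂ) (star v ⬝ᵥ u) := by
    rw [starRingEnd_apply, ← star_dotProduct_star, star_star]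
  rw [this]
  simp [mul_comm]

theorem star_dotProduct_self_eq (u : ι → ℂ) :
    star u ⬝ᵥ u = ((∑ i, ‖u i‖ ^ 2 : ℝ) : ℂ) := by
  rw [dotProduct, Complex.ofReal_sum]
  refine Finset.sum_congr rfl fun i _ => ?_
  rw [Pi.star_apply, Complex.star_def, ← Complex.normSq_eq_conj_mul_self, Complex.normSq_eq_norm_sq]

theorem norm_star_dotProduct_comm (u v : ι → ℂ) : ‖star u ⬝ᵥ v‖ = ‖star v ⬝ᵥ u‖ := by
  rw [← norm_star, ← star_dotProduct_star, star_star]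

theorem posSemidef_sum_vecMulVec {a : ℝ} (ha : 0 ≤ a) {n : ℕ} (H : Fin n → ι → ℂ) :
    ((a : ℂ) • ∑ l, vecMulVec (H l) (star (H l))).PosSemidef :=
  (posSemidef_sum _ fun l _ => posSemidef_vecMulVec_self_star (H l)).smul (by exact_mod_cast ha)

variable [DecidableEq ι]

/-- The Sherman–Morrison formula for a Hermitian rank one perturbation of the identity. -/
theorem inv_one_add_vecMulVec_star {a : ℝ} (ha : 0 ≤ a) (u : ι → ℂ) :
    (1 + (a : ℂ) • vecMulVec u (star u))⁻¹ =
      1 - ((a / (1 + a * ∑ i, ‖u i‖ ^ 2) : ℝ) : ℂ) • vecMulVec u (star u) := by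
  set S := ∑ i, ‖u i‖ ^ 2 with hS
  have hS0 : 0 ≤ S := by positivity
  have h1 : (1 + a * S : ℝ) ≠ 0 := by positivity
  refine inv_eq_right_inv ?_
  have hsq : vecMulVec u (star u) * vecMulVec u (star u) = (S : ℂ) • vecMulVec u (star u) := by
    rw [vecMulVec_mul_vecMulVec, star_dotProduct_self_eq, vecMulVec_smul]
  have e : (a : ℂ) - ((a / (1 + a * S) : ℝ) : ℂ) - a * ((a / (1 + a * S) : ℝ) : ℂ) * S = 0 := by
    have : a - a / (1 + a * S) - a * (a / (1 + a * S)) * S = 0 := by field_simp; ring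
    exact_mod_cast this
  calc _ = 1 + ((a : ℂ) - ((a / (1 + a * S) : ℝ) : ℂ) -
        a * ((a / (1 + a * S) : ℝ) : ℂ) * S) • vecMulVec u (star u) := by
        rw [add_mul, mul_sub, mul_sub, smul_mul_smul_comm, hsq, one_mul, one_mul, mul_one, smul_smul]
        module
    _ = 1 := by rw [e, zero_smul, add_zero]

theorem det_one_add_vecMulVec_star (a : ℝ) (u : ι → ℂ) :
    (1 + (a : ℂ) • vecMulVec u (star u)).det = ((1 + a * ∑ i, ‖u i‖ ^ 2 : ℝ) : ℂ) := by
  rw [← smul_vecMulVec, det_add_vecMulVec]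
  have : ∑ i, ∑ j, ((a : ℂ) • u) i * star u j * (1 : Matrix ι ι ℂ).adjugate j i =
      a * (star u ⬝ᵥ u) := by
    simp [Matrix.one_apply, dotProduct, Finset.mul_sum]
    exact Finset.sum_congr rfl fun i _ => by ring
  rw [this, star_dotProduct_self_eq, det_one]
  push_cast; rfl

/-- The pencil `1 + X y (1 + a u uᴴ)⁻¹` has eigenvalue `1 + yX` on the orthogonal complement of
`u` and `1 + yX / (1 + a ‖u‖²)` on `u`. -/
theorem det_pencil_rank_one [Nonempty ι] {a : ℝ} (ha : 0 ≤ a) (y : ℂ) (u : ι → ℂ) :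
    ((1 : Matrix ι ι ℂ).map C + (X : ℂ[X]) •
      (y • (1 + (a : ℂ) • vecMulVec u (star u))⁻¹).map C).det =
    (1 + C y * X) ^ (Fintype.card ι - 1) +
      (((1 + a * ∑ i, ‖u i‖ ^ 2)⁻¹ : ℝ) : ℂ) •
        (C y * X * (1 + C y * X) ^ (Fintype.card ι - 1)) := by
  set S := ∑ i, ‖u i‖ ^ 2 with hS
  have hS0 : 0 ≤ S := by positivity
  have h1 : (1 + a * S : ℝ) ≠ 0 := by positivity
  obtain ⟨N, hN⟩ : ∃ N, Fintype.card ι = N + 1 := ⟨Fintype.card ι - 1, by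
    have := Fintype.card_pos (α := ι); omega⟩
  set κ : ℂ := ((a / (1 + a * S) : ℝ) : ℂ) with hκ
  have hM : (1 : Matrix ι ι ℂ).map C + (X : ℂ[X]) •
      (y • (1 + (a : ℂ) • vecMulVec u (star u))⁻¹).map C =
      (1 + C y * X) • (1 : Matrix ι ι ℂ[X]) +
        vecMulVec (fun i => -(C y * X * C κ) * C (u i)) (fun i => C (star u i)) := by
    rw [inv_one_add_vecMulVec_star ha, ← hS, ← hκ]
    clear_value κ
    ext1 i j
    by_cases hij : i = j
    · subst hij; simp [vecMulVec_apply]; ring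
    · simp [vecMulVec_apply, hij]; ring
  have hsum : ∑ i, C (u i) * C (star u i) = C (S : ℂ) := by
    rw [hS, ← star_dotProduct_self_eq, dotProduct, map_sum]
    exact Finset.sum_congr rfl fun i _ => by rw [← C_mul, mul_comm]
  have hκS : (1 : ℂ) - κ * S = (((1 + a * S)⁻¹ : ℝ) : ℂ) := by
    have : 1 - a / (1 + a * S) * S = (1 + a * S)⁻¹ := by field_simp; ring
    rw [hκ]
    exact_mod_cast this
  have hadj : ∑ i, ∑ j, -(C y * X * C κ) * C (u i) * C (star u j) *
      ((1 + C y * X) ^ N • (1 : Matrix ι ι ℂ[X])) j i =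
      -(C y * X * C κ) * (1 + C y * X) ^ N * C (S : ℂ) := by
    rw [← hsum, Finset.mul_sum]
    refine Finset.sum_congr rfl fun i _ => ?_
    rw [Finset.sum_eq_single i (fun j _ hj => by simp [hj]) (by simp)]
    simp; ring
  rw [hM, det_add_vecMulVec, adjugate_smul, adjugate_one, hN, Nat.add_sub_cancel, hadj, ← hκS,
    det_smul, hN, det_one, smul_eq_C_mul, C_sub, C_mul, C_1]
  ring

/-- The average of `det (1 + yW) / det (1 + aW)` for `W = ∑ₗ hₗhₗ†` with `n` independent Gaussian
columns `hₗ`. The denominator is written as the Gaussian average of `exp (-a u†Wu)`, a product of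
weights on the columns, after which only one vector `u` is left to average over. -/
theorem integral_det_ratio [Nonempty ι] {a : ℝ} (ha : 0 ≤ a) (y : ℂ) (n : ℕ) :
    ∫ H : Fin n → ι → ℂ, (1 + y • ∑ l, vecMulVec (H l) (star (H l))).det /
        (1 + (a : ℂ) • ∑ l, vecMulVec (H l) (star (H l))).det
      ∂(Measure.pi fun _ => Measure.pi fun _ : ι => stdComplexGaussian) =
    (gaussRadial ι a n : ℂ) * descCoeffSum n ((1 + C y * X) ^ (Fintype.card ι - 1)) +
    (gaussRadial ι a (n + 1) : ℂ) *
      descCoeffSum n (C y * X * (1 + C y * X) ^ (Fintype.card ι - 1)) := by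
  set γ : Measure (ι → ℂ) := Measure.pi fun _ : ι => stdComplexGaussian with hγ
  have hden : ∀ H : Fin n → ι → ℂ,
      ((1 + (a : ℂ) • ∑ l, vecMulVec (H l) (star (H l))).det)⁻¹ =
      ∫ u, ∏ l, (Real.exp (-(a * ‖star u ⬝ᵥ H l‖ ^ 2)) : ℂ) ∂γ := by
    intro H
    rw [← (integral_exp_neg_quadratic (posSemidef_sum_vecMulVec ha H)).1]
    refine integral_congr_ae (Filter.Eventually.of_forall fun u => ?_)
    simp only
    rw [← Complex.ofReal_prod, ← Real.exp_sum, Finset.sum_neg_distrib, smul_mulVec,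
      dotProduct_smul, sum_mulVec, dotProduct_sum, Finset.smul_sum, Complex.re_sum]
    refine congrArg _ (congrArg _ (congrArg _ (Finset.sum_congr rfl fun l _ => ?_)))
    rw [star_dotProduct_vecMulVec_mulVec, smul_eq_mul, ← Complex.ofReal_mul, Complex.ofReal_re,
      norm_star_dotProduct_comm]
  have hmeasw : Measurable (fun z : (Fin n → ι → ℂ) × (ι → ℂ) =>
      ∏ l, (Real.exp (-(a * ‖star z.2 ⬝ᵥ z.1 l‖ ^ 2)) : ℂ)) := by
    refine Finset.measurable_prod _ fun l _ => ?_
    have : Measurable (fun z : (Fin n → ι → ℂ) × (ι → ℂ) => star z.2 ⬝ᵥ z.1 l) :=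
      Finset.measurable_sum _ fun i _ => by
        simp only [Pi.star_apply]
        fun_prop
    fun_prop
  have hbound : ∀ u h : ι → ℂ, ‖(Real.exp (-(a * ‖star u ⬝ᵥ h‖ ^ 2)) : ℂ)‖ ≤ 1 := by
    intro u h
    rw [Complex.norm_real, Real.norm_eq_abs, Real.abs_exp, Real.exp_le_one_iff]
    have : 0 ≤ a * ‖star u ⬝ᵥ h‖ ^ 2 := by positivity
    linarith
  have hdetint : Integrable (fun H : Fin n → ι → ℂ =>
      (1 + y • ∑ l, vecMulVec (H l) (star (H l))).det) (Measure.pi fun _ => γ) := by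
    have := integrable_prod_mul_det_add_sum_vecMulVec (ν := γ) (w := fun _ => 1)
      (integrable_const 1) n (fun h => y • h) (fun h => star h) (fun i j => by
        simpa [mul_assoc] using (integrable_pi_mul_star i j).const_mul y) 1
    refine this.congr (Filter.Eventually.of_forall fun H => ?_)
    simp [Finset.smul_sum, smul_vecMulVec]
  have hprod : Integrable (fun z : (Fin n → ι → ℂ) × (ι → ℂ) =>
      (∏ l, (Real.exp (-(a * ‖star z.2 ⬝ᵥ z.1 l‖ ^ 2)) : ℂ)) *
        (1 + y • ∑ l, vecMulVec (z.1 l) (star (z.1 l))).det)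
      ((Measure.pi fun _ => γ).prod γ) := by
    refine (hdetint.comp_fst γ).bdd_mul (c := 1) hmeasw.aestronglyMeasurable
      (Filter.Eventually.of_forall fun z => ?_)
    rw [norm_prod]
    exact Finset.prod_le_one (fun l _ => norm_nonneg _) fun l _ => hbound _ _
  -- for fixed `u` the weight is a product over the columns, each of which is then Gaussian with
  -- covariance `(1 + a u uᴴ)⁻¹`
  have hinner : ∀ u : ι → ℂ, ∫ H : Fin n → ι → ℂ,
      (∏ l, (Real.exp (-(a * ‖star u ⬝ᵥ H l‖ ^ 2)) : ℂ)) *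
        (1 + y • ∑ l, vecMulVec (H l) (star (H l))).det ∂(Measure.pi fun _ => γ) =
      ((((1 + a * ∑ i, ‖u i‖ ^ 2) ^ n)⁻¹ : ℝ) : ℂ) *
        descCoeffSum n ((1 + C y * X) ^ (Fintype.card ι - 1)) +
      ((((1 + a * ∑ i, ‖u i‖ ^ 2) ^ (n + 1))⁻¹ : ℝ) : ℂ) *
        descCoeffSum n (C y * X * (1 + C y * X) ^ (Fintype.card ι - 1)) := by
    intro u
    set S := ∑ i, ‖u i‖ ^ 2 with hS
    have hpos : ((a : ℂ) • vecMulVec u (star u)).PosSemidef :=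
      (posSemidef_vecMulVec_self_star u).smul (by exact_mod_cast ha)
    have hwq : ∀ h : ι → ℂ, (Real.exp (-(a * ‖star u ⬝ᵥ h‖ ^ 2)) : ℂ) =
        (Real.exp (-(star h ⬝ᵥ ((a : ℂ) • vecMulVec u (star u)) *ᵥ h).re) : ℂ) := by
      intro h
      rw [smul_mulVec, dotProduct_smul, star_dotProduct_vecMulVec_mulVec, smul_eq_mul,
        ← Complex.ofReal_mul, Complex.ofReal_re]
    have hq := integral_exp_neg_quadratic hpos
    have hmw : Measurable (fun h : ι → ℂ => (Real.exp (-(a * ‖star u ⬝ᵥ h‖ ^ 2)) : ℂ)) := by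
      have : Measurable (fun h : ι → ℂ => star u ⬝ᵥ h) :=
        Finset.measurable_sum _ fun i _ => by fun_prop
      fun_prop
    have hint : ∀ i j, Integrable (fun h : ι → ℂ => (Real.exp (-(a * ‖star u ⬝ᵥ h‖ ^ 2)) : ℂ) *
        ((y • h) i * star h j)) γ := by
      intro i j
      refine Integrable.bdd_mul (c := 1) ?_ hmw.aestronglyMeasurable
        (Filter.Eventually.of_forall fun h => hbound _ _)
      simpa [mul_assoc] using (integrable_pi_mul_star i j).const_mul y
    have hw : Integrable (fun h : ι → ℂ => (Real.exp (-(a * ‖star u ⬝ᵥ h‖ ^ 2)) : ℂ)) γ := by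
      refine (Integrable.bdd_mul (integrable_const (1 : ℂ)) hmw.aestronglyMeasurable
        (Filter.Eventually.of_forall fun h => hbound u h)).congr
        (Filter.Eventually.of_forall fun h => mul_one _)
    have hmain := integral_prod_mul_det_add_sum_vecMulVec (ν := γ) hw
      (Z := (((1 + a * S)⁻¹ : ℝ) : ℂ)) ?_ (fun h => y • h) (fun h => star h)
      (y • (1 + (a : ℂ) • vecMulVec u (star u))⁻¹) hint ?_ n 1
    · rw [det_pencil_rank_one ha, map_add, map_smul, smul_eq_mul, mul_add, ← mul_assoc] at hmain
      rw [← inv_pow, ← inv_pow, pow_succ (1 + a * S)⁻¹, Complex.ofReal_mul, Complex.ofReal_pow,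
        ← hmain]
      simp only [Finset.smul_sum, smul_vecMulVec]
    · simp only [hwq]
      rw [hq.1, det_one_add_vecMulVec_star, Complex.ofReal_inv]
    · intro i j
      have e : ∀ h : ι → ℂ, (Real.exp (-(a * ‖star u ⬝ᵥ h‖ ^ 2)) : ℂ) * ((y • h) i * star h j) =
          y * ((Real.exp (-(star h ⬝ᵥ ((a : ℂ) • vecMulVec u (star u)) *ᵥ h).re) : ℂ) *
            (h i * star (h j))) := by
        intro h; rw [hwq]; simp; ring
      simp only [e]
      rw [integral_const_mul, hq.2, det_one_add_vecMulVec_star, Complex.ofReal_inv, Matrix.smul_apply,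
        smul_eq_mul]
      ring
  calc _ = ∫ H : Fin n → ι → ℂ, ∫ u, (∏ l, (Real.exp (-(a * ‖star u ⬝ᵥ H l‖ ^ 2)) : ℂ)) *
        (1 + y • ∑ l, vecMulVec (H l) (star (H l))).det ∂γ ∂(Measure.pi fun _ => γ) := by
        refine integral_congr_ae (Filter.Eventually.of_forall fun H => ?_)
        simp only
        rw [integral_mul_const, ← hden, div_eq_inv_mul]
    _ = ∫ u, ∫ H : Fin n → ι → ℂ, (∏ l, (Real.exp (-(a * ‖star u ⬝ᵥ H l‖ ^ 2)) : ℂ)) *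
        (1 + y • ∑ l, vecMulVec (H l) (star (H l))).det ∂(Measure.pi fun _ => γ) ∂γ :=
        integral_integral_swap hprod
    _ = _ := by
        have hi : ∀ m : ℕ, Integrable (fun u : ι → ℂ =>
            ((((1 + a * ∑ i, ‖u i‖ ^ 2) ^ m)⁻¹ : ℝ) : ℂ)) γ := by
          intro m
          refine Integrable.of_bound (C := 1) (Measurable.aestronglyMeasurable (by fun_prop))
            (Filter.Eventually.of_forall fun u => ?_)
          have h0 : 0 ≤ a * ∑ i, ‖u i‖ ^ 2 := by positivity
          rw [Complex.norm_real, Real.norm_eq_abs, abs_of_nonneg (by positivity)]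
          exact inv_le_one_of_one_le₀ (one_le_pow₀ (by linarith))
        simp only [hinner]
        rw [integral_add ((hi _).mul_const _) ((hi _).mul_const _), integral_mul_const,
          integral_mul_const, integral_complex_ofReal, integral_complex_ofReal]
        rfl

end GaussianRatio

/-! ### Orthogonality of the averaged ratio -/

section Laguerre

open Set

/-- `∫₀^∞ sᵐ e⁻ˢ (1 + a s)⁻ˡ ds`. -/
noncomputable def lagInt (a : ℝ) (m l : ℕ) : ℝ :=
  ∫ s in Ioi (0 : ℝ), s ^ m * Real.exp (-s) / (1 + a * s) ^ l

variable {a : ℝ}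

theorem integrableOn_pow_mul_exp_neg (m : ℕ) :
    IntegrableOn (fun s : ℝ => s ^ m * Real.exp (-s)) (Ioi 0) := by
  have h := Real.GammaIntegral_convergent (s := m + 1) (by positivity)
  refine h.congr_fun (fun s hs => ?_) measurableSet_Ioi
  simp only [add_sub_cancel_right, Real.rpow_natCast]
  ring

theorem integrableOn_lagInt (ha : 0 ≤ a) (m l : ℕ) :
    IntegrableOn (fun s : ℝ => s ^ m * Real.exp (-s) / (1 + a * s) ^ l) (Ioi 0) := by
  refine (integrableOn_pow_mul_exp_neg m).mono' (Measurable.aestronglyMeasurable (by fun_prop)) ?_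
  refine (ae_restrict_iff' measurableSet_Ioi).2 (Filter.Eventually.of_forall fun s hs => ?_)
  have hs0 : (0 : ℝ) < s := hs
  have h1 : 0 ≤ a * s := by positivity
  rw [Real.norm_eq_abs, abs_of_nonneg (by positivity)]
  exact div_le_self (by positivity) (one_le_pow₀ (by linarith))

theorem lagInt_zero_right (a : ℝ) (m : ℕ) : lagInt a m 0 = m.factorial := by
  rw [lagInt, ← Real.Gamma_nat_eq_factorial, Real.Gamma_eq_integral (by positivity)]
  refine setIntegral_congr_fun measurableSet_Ioi fun s hs => ?_
  simp only [add_sub_cancel_right, Real.rpow_natCast, pow_zero, div_one]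
  ring

/-- From `1 / (1 + as)ˡ = (1 + as) / (1 + as)ˡ⁺¹`. -/
theorem lagInt_eq_add (ha : 0 ≤ a) (m l : ℕ) :
    lagInt a m l = lagInt a m (l + 1) + a * lagInt a (m + 1) (l + 1) := by
  rw [lagInt, lagInt, lagInt, ← integral_const_mul, ← integral_add (integrableOn_lagInt ha _ _)
    ((integrableOn_lagInt ha _ _).const_mul _)]
  refine setIntegral_congr_fun measurableSet_Ioi fun s hs => ?_
  have hs0 : (0 : ℝ) < s := hs
  have h1 : 1 + a * s ≠ 0 := by positivity
  rw [← mul_div_assoc, ← add_div, div_eq_div_iff (pow_ne_zero _ h1) (pow_ne_zero _ h1)]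
  ring

/-- Integration by parts: the derivative of `s ^ (m + 1) e⁻ˢ / (1 + as)ˡ` integrates to zero. -/
theorem lagInt_succ_sub (ha : 0 ≤ a) (m l : ℕ) :
    lagInt a (m + 1) l - (m + 1) * lagInt a m l = -a * l * lagInt a (m + 1) (l + 1) := by
  have hderiv : ∀ s ∈ Ici (0 : ℝ), HasDerivAt
      (fun s : ℝ => s ^ (m + 1) * Real.exp (-s) / (1 + a * s) ^ l)
      ((m + 1) * (s ^ m * Real.exp (-s) / (1 + a * s) ^ l) -
        s ^ (m + 1) * Real.exp (-s) / (1 + a * s) ^ l -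
        a * l * (s ^ (m + 1) * Real.exp (-s) / (1 + a * s) ^ (l + 1))) s := by
    intro s hs
    have hs0 : (0 : ℝ) ≤ s := hs
    have h1 : 1 + a * s ≠ 0 := by positivity
    have h2 : HasDerivAt (fun s : ℝ => 1 + a * s) a s := by
      simpa using ((hasDerivAt_id s).const_mul a).const_add 1
    have h3 : HasDerivAt (fun s : ℝ => s ^ (m + 1) * Real.exp (-s) / (1 + a * s) ^ l) _ s :=
      ((hasDerivAt_pow (m + 1) s).mul (hasDerivAt_neg s).exp).div (h2.pow l) (pow_ne_zero l h1)
    refine h3.congr_deriv ?_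
    simp only [Pi.mul_apply, Nat.add_sub_cancel]
    rcases l with _ | l
    · simp
      ring
    · simp only [Nat.add_sub_cancel]
      push_cast
      field_simp
      ring
  have hI : IntegrableOn (fun s : ℝ => (m + 1) * (s ^ m * Real.exp (-s) / (1 + a * s) ^ l) -
        s ^ (m + 1) * Real.exp (-s) / (1 + a * s) ^ l) (Ioi 0) :=
    ((integrableOn_lagInt ha m l).const_mul (m + 1)).sub (integrableOn_lagInt ha (m + 1) l)
  have hJ : IntegrableOn (fun s : ℝ => a * l * (s ^ (m + 1) * Real.exp (-s) /
      (1 + a * s) ^ (l + 1))) (Ioi 0) := (integrableOn_lagInt ha (m + 1) (l + 1)).const_mul _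
  have hlim : Filter.Tendsto (fun s : ℝ => s ^ (m + 1) * Real.exp (-s) / (1 + a * s) ^ l)
      Filter.atTop (nhds 0) := by
    refine squeeze_zero' ?_ ?_ (Real.tendsto_pow_mul_exp_neg_atTop_nhds_zero (m + 1))
    · filter_upwards [Filter.eventually_ge_atTop 0] with s hs
      positivity
    · filter_upwards [Filter.eventually_ge_atTop 0] with s hs
      have h1 : 0 ≤ a * s := by positivity
      exact div_le_self (by positivity) (one_le_pow₀ (by linarith))
  have h := integral_Ioi_of_hasDerivAt_of_tendsto' hderiv (hI.sub hJ) hlim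
  rw [integral_sub hI hJ, integral_sub ((integrableOn_lagInt ha m l).const_mul _)
    (integrableOn_lagInt ha (m + 1) l), integral_const_mul, integral_const_mul] at h
  simp only [ne_eq, Nat.succ_ne_zero, not_false_eq_true, zero_pow, zero_mul, zero_div,
    sub_zero] at h
  simp only [lagInt]
  linarith

/-- Write `m! (1 + a ‖u‖²)^(-m-1)` as `∫₀^∞ sᵐ exp (-s (1 + a ‖u‖²)) ds` and average over `u`
first. -/
theorem factorial_mul_gaussRadial (ι : Type*) [Fintype ι] (ha : 0 ≤ a) (m : ℕ) :
    (m.factorial : ℝ) * gaussRadial ι a (m + 1) = lagInt a m (Fintype.card ι) := by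
  have hswap := integral_integral_swap (μ := Measure.pi fun _ : ι => stdComplexGaussian)
    (ν := volume.restrict (Ioi (0 : ℝ)))
    -- with `|s|` the first factor is at most `1` for every real `s`, not only almost everywhere
    (f := fun u s => Real.exp (-(|s| * (a * ∑ i, ‖u i‖ ^ 2))) * (s ^ m * Real.exp (-s))) ?_
  · have hleft : ∀ u : ι → ℂ, ∫ s in Ioi (0 : ℝ),
        Real.exp (-(|s| * (a * ∑ i, ‖u i‖ ^ 2))) * (s ^ m * Real.exp (-s)) =
        m.factorial * ((1 + a * ∑ i, ‖u i‖ ^ 2) ^ (m + 1))⁻¹ := by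
      intro u
      have hpos : 0 < 1 + a * ∑ i, ‖u i‖ ^ 2 := by positivity
      have h := Real.integral_rpow_mul_exp_neg_mul_Ioi (a := m + 1) (by positivity) hpos
      rw [Real.Gamma_nat_eq_factorial, one_div, ← Nat.cast_succ, Real.rpow_natCast, inv_pow,
        mul_comm (_⁻¹)] at h
      rw [← h]
      refine setIntegral_congr_fun measurableSet_Ioi fun s hs => ?_
      have hs0 : (0 : ℝ) < s := hs
      simp only [Nat.cast_succ, add_sub_cancel_right, Real.rpow_natCast]
      rw [abs_of_pos hs0, mul_left_comm, ← Real.exp_add]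
      congr 2
      ring
    have hright : ∀ s ∈ Ioi (0 : ℝ), ∫ u : ι → ℂ,
        Real.exp (-(|s| * (a * ∑ i, ‖u i‖ ^ 2))) * (s ^ m * Real.exp (-s))
          ∂(Measure.pi fun _ : ι => stdComplexGaussian) =
        s ^ m * Real.exp (-s) / (1 + a * s) ^ (Fintype.card ι) := by
      intro s hs
      have hs0 : (0 : ℝ) < s := hs
      have h := integral_diagonal_gaussian (ι := ι) (d := fun _ => s * a)
        (fun _ => by positivity)
      simp only [Finset.prod_const, Finset.card_univ, ← Complex.ofReal_prod,
        integral_complex_ofReal] at h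
      have h' : ∫ u : ι → ℂ, ∏ l, Real.exp (-(s * a * ‖u l‖ ^ 2))
          ∂(Measure.pi fun _ : ι => stdComplexGaussian) =
          ((1 + s * a)⁻¹) ^ Fintype.card ι := by exact_mod_cast h
      rw [integral_mul_const, abs_of_pos hs0, div_eq_inv_mul, ← inv_pow, mul_comm a s, ← h']
      congr 1
      refine integral_congr_ae (Filter.Eventually.of_forall fun u => ?_)
      simp only
      rw [← Real.exp_sum, Finset.sum_neg_distrib, ← Finset.mul_sum, mul_assoc]
    rw [gaussRadial, ← integral_const_mul, lagInt]
    simp only [hleft] at hswap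
    rw [hswap]
    exact setIntegral_congr_fun measurableSet_Ioi hright
  · refine ((integrableOn_pow_mul_exp_neg m).integrable.comp_snd _).bdd_mul (c := 1)
      (Measurable.aestronglyMeasurable (by fun_prop)) (Filter.Eventually.of_forall fun z => ?_)
    have h0 : 0 ≤ |z.2| * (a * ∑ i, ‖z.1 i‖ ^ 2) := by positivity
    rw [Real.norm_eq_abs, Real.abs_exp, Real.exp_le_one_iff]
    linarith

/-- The iterated difference `∑ₖ (-1)ᵏ (r choose k) p (p - 1) ⋯ (p - k + 1) φ (p - k)`. -/
noncomputable def descDiff (φ : ℕ → ℝ) (r p : ℕ) : ℝ :=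
  ∑ k ∈ Finset.range (r + 1), (-1) ^ k * (r.choose k : ℝ) * p.descFactorial k * φ (p - k)

theorem descDiff_zero (φ : ℕ → ℝ) (p : ℕ) : descDiff φ 0 p = φ p := by simp [descDiff]

theorem descDiff_succ (φ : ℕ → ℝ) (r p : ℕ) :
    descDiff φ (r + 1) p = descDiff φ r p - p * descDiff φ r (p - 1) := by
  have hp : ∀ k, (p.descFactorial (k + 1) : ℝ) * φ (p - (k + 1)) =
      p * ((p - 1).descFactorial k * φ (p - 1 - k)) := by
    intro k
    rcases p with _ | p
    · simp
    · rw [Nat.succ_descFactorial_succ, Nat.add_sub_add_right]; push_cast; ring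
  unfold descDiff
  rw [Finset.sum_range_succ' _ (r + 1)]
  have h1 : ∑ k ∈ Finset.range (r + 1), (-1) ^ k * (r.choose k : ℝ) * p.descFactorial k *
      φ (p - k) = ∑ k ∈ Finset.range (r + 1), (-1) ^ (k + 1) * (r.choose (k + 1) : ℝ) *
      p.descFactorial (k + 1) * φ (p - (k + 1)) + φ p := by
    have := Finset.sum_range_succ' (fun k => (-1) ^ k * (r.choose k : ℝ) * p.descFactorial k *
      φ (p - k)) (r + 1)
    rw [Finset.sum_range_succ] at this
    simpa using this
  rw [h1, Finset.mul_sum, add_sub_right_comm, ← Finset.sum_sub_distrib]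
  congr 1
  · refine Finset.sum_congr rfl fun k _ => ?_
    rw [mul_assoc, hp, mul_assoc ((-1) ^ (k + 1) * _ : ℝ), hp, Nat.choose_succ_succ]
    push_cast
    ring
  · simp

/-- The moments of `sʲ e⁻ˢ`: the iterated difference vanishes for `j < r`. -/
theorem descDiff_add_factorial (r p j : ℕ) (hrp : r ≤ p) :
    descDiff (fun m => ((m + j).factorial : ℝ)) r p =
      j.descFactorial r * ((p + j - r).factorial : ℝ) := by
  induction r generalizing p with
  | zero => simp [descDiff_zero]
  | succ r ih =>
    rw [descDiff_succ, ih p (by omega), ih (p - 1) (by omega), Nat.descFactorial_succ]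
    rcases le_or_gt r j with hj | hj
    · obtain ⟨p, rfl⟩ : ∃ p', p = p' + 1 := ⟨p - 1, by omega⟩
      rw [show p + 1 + j - r = (p + j - r) + 1 by omega, show p + 1 - 1 + j - r = p + j - r by omega,
        show p + 1 + j - (r + 1) = p + j - r by omega, Nat.factorial_succ]
      push_cast [Nat.cast_sub hj, Nat.cast_sub (show r ≤ p + j by omega)]
      ring
    · simp [Nat.descFactorial_eq_zero_iff_lt.2 hj]

/-- Each difference is one integration by parts. -/
theorem descDiff_lagInt (ha : 0 ≤ a) (r p l : ℕ) (hrp : r ≤ p) :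
    descDiff (fun m => lagInt a m l) r p = (-a) ^ r * l.ascFactorial r * lagInt a p (l + r) := by
  induction r generalizing p with
  | zero => simp [descDiff_zero]
  | succ r ih =>
    rw [descDiff_succ, ih p (by omega), ih (p - 1) (by omega), Nat.ascFactorial_succ]
    obtain ⟨p, rfl⟩ : ∃ p', p = p' + 1 := ⟨p - 1, by omega⟩
    have h := lagInt_succ_sub ha p (l + r)
    simp only [Nat.add_sub_cancel]
    push_cast at h ⊢
    rw [← add_assoc]
    linear_combination (-a) ^ r * l.ascFactorial r * h

/-- The mean of `det (1 + yW) / det (1 + aW)` for the Wishart matrix `W` of `p` independent standard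
complex Gaussian columns of length `r + 1`; a polynomial in `y`. -/
noncomputable def ratioPoly (a : ℝ) (r p : ℕ) (y : ℝ) : ℝ :=
  gaussRadial (Fin (r + 1)) a p *
      ∑ k ∈ Finset.range (r + 1), (p.descFactorial k : ℝ) * r.choose k * y ^ k +
    gaussRadial (Fin (r + 1)) a (p + 1) *
      ∑ k ∈ Finset.range (r + 1), (p.descFactorial (k + 1) : ℝ) * r.choose k * y ^ (k + 1)

/-- The moments `∫₀^∞ sʲ · sᵖ G(-1/s) e⁻ˢ (1 + as)⁻ˡ ds` of the averaged ratio `G`, written as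
iterated differences. -/
noncomputable def ratioMoment (a : ℝ) (r p j l : ℕ) : ℝ :=
  gaussRadial (Fin (r + 1)) a p * descDiff (fun m => lagInt a (m + j) l) r p -
    p * gaussRadial (Fin (r + 1)) a (p + 1) * descDiff (fun m => lagInt a (m + j) l) r (p - 1)

theorem pow_mul_ratioPoly {r p : ℕ} (hrp : r < p) {s : ℝ} (hs : 0 < s) (j l : ℕ) :
    s ^ j * (s ^ p * ratioPoly a r p (-s⁻¹)) * Real.exp (-s) / (1 + a * s) ^ l =
    gaussRadial (Fin (r + 1)) a p * (∑ k ∈ Finset.range (r + 1),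
        (-1) ^ k * (r.choose k : ℝ) * p.descFactorial k *
          (s ^ (p - k + j) * Real.exp (-s) / (1 + a * s) ^ l)) -
    p * gaussRadial (Fin (r + 1)) a (p + 1) * (∑ k ∈ Finset.range (r + 1),
        (-1) ^ k * (r.choose k : ℝ) * (p - 1).descFactorial k *
          (s ^ (p - 1 - k + j) * Real.exp (-s) / (1 + a * s) ^ l)) := by
  have h1 : s ^ j * (s ^ p * ∑ k ∈ Finset.range (r + 1),
      (p.descFactorial k : ℝ) * r.choose k * (-s⁻¹) ^ k) * Real.exp (-s) / (1 + a * s) ^ l =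
      ∑ k ∈ Finset.range (r + 1), (-1) ^ k * (r.choose k : ℝ) * p.descFactorial k *
          (s ^ (p - k + j) * Real.exp (-s) / (1 + a * s) ^ l) := by
    simp only [Finset.mul_sum, Finset.sum_mul, Finset.sum_div]
    refine Finset.sum_congr rfl fun k hk => ?_
    have hk' : k ≤ p := by have := Finset.mem_range.1 hk; omega
    have : s ^ (p - k + j) = s ^ p * (s⁻¹) ^ k * s ^ j := by
      rw [pow_add, pow_sub₀ s hs.ne' hk', inv_pow]
    rw [this, neg_pow]
    ring
  have h2 : s ^ j * (s ^ p * ∑ k ∈ Finset.range (r + 1),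
      (p.descFactorial (k + 1) : ℝ) * r.choose k * (-s⁻¹) ^ (k + 1)) * Real.exp (-s) /
        (1 + a * s) ^ l =
      -(p * ∑ k ∈ Finset.range (r + 1), (-1) ^ k * (r.choose k : ℝ) * (p - 1).descFactorial k *
          (s ^ (p - 1 - k + j) * Real.exp (-s) / (1 + a * s) ^ l)) := by
    simp only [Finset.mul_sum, Finset.sum_mul, Finset.sum_div, ← Finset.sum_neg_distrib]
    refine Finset.sum_congr rfl fun k hk => ?_
    obtain ⟨p, rfl⟩ : ∃ p', p = p' + 1 := ⟨p - 1, by omega⟩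
    have hk' : k ≤ p := by have := Finset.mem_range.1 hk; omega
    have : s ^ (p - k + j) = s ^ (p + 1) * (s⁻¹) ^ (k + 1) * s ^ j := by
      rw [pow_add, pow_sub₀ s hs.ne' hk', inv_pow]
      field_simp
      ring
    rw [Nat.add_sub_cancel, this, neg_pow, Nat.succ_descFactorial_succ]
    push_cast
    ring
  rw [ratioPoly, mul_add (s ^ p), mul_add (s ^ j), add_mul, add_div]
  linear_combination gaussRadial (Fin (r + 1)) a p * h1 + gaussRadial (Fin (r + 1)) a (p + 1) * h2

theorem integrableOn_ratioPoly (ha : 0 ≤ a) {r p : ℕ} (hrp : r < p) (j l : ℕ) :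
    IntegrableOn (fun s => s ^ j * (s ^ p * ratioPoly a r p (-s⁻¹)) * Real.exp (-s) /
      (1 + a * s) ^ l) (Ioi 0) := by
  refine IntegrableOn.congr_fun ?_ (fun s hs => (pow_mul_ratioPoly hrp hs j l).symm)
    measurableSet_Ioi
  exact ((integrable_finsetSum _ fun k _ => (integrableOn_lagInt ha _ _).const_mul _).const_mul
    _).sub ((integrable_finsetSum _ fun k _ => (integrableOn_lagInt ha _ _).const_mul _).const_mul _)

theorem integral_ratioPoly (ha : 0 ≤ a) {r p : ℕ} (hrp : r < p) (j l : ℕ) :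
    ∫ s in Ioi (0 : ℝ), s ^ j * (s ^ p * ratioPoly a r p (-s⁻¹)) * Real.exp (-s) /
      (1 + a * s) ^ l = ratioMoment a r p j l := by
  have hi : ∀ (c : ℕ → ℝ) (e : ℕ → ℕ), Integrable (fun s : ℝ => ∑ k ∈ Finset.range (r + 1),
      c k * (s ^ e k * Real.exp (-s) / (1 + a * s) ^ l)) (volume.restrict (Ioi 0)) := fun c e =>
    integrable_finsetSum _ fun k _ => (integrableOn_lagInt ha _ _).const_mul _
  rw [setIntegral_congr_fun measurableSet_Ioi (fun s hs => pow_mul_ratioPoly hrp hs j l),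
    integral_sub ((hi _ _).const_mul _) ((hi _ _).const_mul _), integral_const_mul,
    integral_const_mul, integral_finsetSum _ fun k _ => (integrableOn_lagInt ha _ _).const_mul _,
    integral_finsetSum _ fun k _ => (integrableOn_lagInt ha _ _).const_mul _]
  simp only [integral_const_mul]
  rfl

theorem ratioMoment_eq_add (ha : 0 ≤ a) (r p j l : ℕ) :
    ratioMoment a r p j l = ratioMoment a r p j (l + 1) + a * ratioMoment a r p (j + 1) (l + 1) := by
  have h : ∀ p, descDiff (fun m => lagInt a (m + j) l) r p =
      descDiff (fun m => lagInt a (m + j) (l + 1)) r p +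
        a * descDiff (fun m => lagInt a (m + (j + 1)) (l + 1)) r p := by
    intro p
    simp only [descDiff, Finset.mul_sum, ← Finset.sum_add_distrib]
    refine Finset.sum_congr rfl fun k _ => ?_
    rw [lagInt_eq_add ha, add_assoc (p - k) j 1]
    ring
  simp only [ratioMoment, h]
  ring

/-- Without denominator, orthogonality to degrees below `r` holds for both terms of the averaged
ratio separately: each is a Laguerre-type polynomial. -/
theorem ratioMoment_zero_right {r p j : ℕ} (hrp : r < p) (hj : j < r) :
    ratioMoment a r p j 0 = 0 := by
  simp only [ratioMoment, lagInt_zero_right]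
  rw [descDiff_add_factorial _ _ _ hrp.le, descDiff_add_factorial _ _ _ (by omega),
    Nat.descFactorial_eq_zero_iff_lt.2 hj]
  simp

/-- The two coefficients of the averaged ratio are exactly those that make it orthogonal to the
constants: `(p-1)! J_p` and `p! J_{p+1}` are the two integrals that the iterated differences
produce. -/
theorem ratioMoment_zero_one (ha : 0 ≤ a) {r p : ℕ} (hrp : r < p) :
    ratioMoment a r p 0 1 = 0 := by
  obtain ⟨p, rfl⟩ : ∃ p', p = p' + 1 := ⟨p - 1, by omega⟩
  have h1 := factorial_mul_gaussRadial (Fin (r + 1)) ha p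
  have h2 := factorial_mul_gaussRadial (Fin (r + 1)) ha (p + 1)
  rw [Fintype.card_fin] at h1 h2
  simp only [ratioMoment, add_zero]
  rw [descDiff_lagInt ha _ _ _ hrp.le, descDiff_lagInt ha _ _ _ (by omega), Nat.add_sub_cancel,
    add_comm 1 r, ← h1, ← h2, Nat.factorial_succ]
  push_cast
  ring

/-- Orthogonality of the averaged ratio to all degrees up to `r`, for the weight with denominator
`1 + as`. -/
theorem ratioMoment_one (ha : 0 < a) {r p j : ℕ} (hrp : r < p) (hj : j ≤ r) :
    ratioMoment a r p j 1 = 0 := by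
  induction j with
  | zero => exact ratioMoment_zero_one ha.le hrp
  | succ j ih =>
    have h := ratioMoment_eq_add ha.le r p j 0
    rw [ratioMoment_zero_right hrp (by omega), zero_add, ih (by omega), zero_add] at h
    exact (mul_eq_zero.1 h.symm).resolve_left ha.ne'

/-- Orthogonality of the averaged ratio to the basis `sᵐ (1 + as)ʳ⁻ᵐ` of the polynomials of degree
at most `r`. -/
theorem integral_pow_mul_ratioPoly_eq_zero (ha : 0 < a) {r p m : ℕ} (hrp : r < p) (hm : m ≤ r) :
    ∫ s in Ioi (0 : ℝ), s ^ m * (1 + a * s) ^ (r - m) * (s ^ p * ratioPoly a r p (-s⁻¹)) *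
      Real.exp (-s) / (1 + a * s) = 0 := by
  have e : ∀ s : ℝ, s ^ m * (1 + a * s) ^ (r - m) * (s ^ p * ratioPoly a r p (-s⁻¹)) *
      Real.exp (-s) / (1 + a * s) = ∑ i ∈ Finset.range (r - m + 1), ((r - m).choose i * a ^ i) *
        (s ^ (m + i) * (s ^ p * ratioPoly a r p (-s⁻¹)) * Real.exp (-s) / (1 + a * s) ^ 1) := by
    intro s
    rw [add_comm 1 (a * s), add_pow]
    simp only [Finset.mul_sum, Finset.sum_mul, Finset.sum_div]
    refine Finset.sum_congr rfl fun i _ => ?_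
    ring
  simp only [e]
  rw [integral_finsetSum _ fun i _ => (integrableOn_ratioPoly ha.le hrp _ _).const_mul _]
  refine Finset.sum_eq_zero fun i hi => ?_
  have := Finset.mem_range.1 hi
  rw [integral_const_mul, integral_ratioPoly ha.le hrp, ratioMoment_one ha hrp (by omega), mul_zero]

end Laguerre

/-! ### The determinant of the matrix of confluent hypergeometric functions -/

section Determinants

open Matrix

/-- The identity plus a companion matrix with scaled columns. Expansion along the first
row: besides the corner there is only the last entry, whose minor is
triangular. -/
theorem det_one_add_shift {R : Type*} [CommRing R] (n : ℕ) (b c : ℕ → R) :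
    (of fun i j : Fin (n + 1) => (if i = j then 1 else 0) +
      b j * (if (j : ℕ) = n then c i else if (i : ℕ) = j + 1 then 1 else 0)).det =
    1 + ∑ i ∈ Finset.range (n + 1), (-1) ^ (n - i) * c i * ∏ l ∈ Finset.Ico i (n + 1), b l := by
  induction n generalizing b c with
  | zero => simp; ring
  | succ n ih =>
    rw [det_succ_row_zero, Fin.sum_univ_succ, Fin.sum_univ_castSucc, Finset.sum_eq_zero, zero_add]
    · have h1 : ((of fun i j : Fin (n + 1 + 1) => (if i = j then (1 : R) else 0) +
          b j * (if (j : ℕ) = n + 1 then c i else if (i : ℕ) = j + 1 then 1 else 0)).submatrix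
            Fin.succ (Fin.succAbove 0)) = of fun i j : Fin (n + 1) => (if i = j then 1 else 0) +
            b (j + 1) * (if (j : ℕ) = n then c (i + 1) else if (i : ℕ) = j + 1 then 1 else 0) := by
        ext i j
        simp
      have h2 : ((of fun i j : Fin (n + 1 + 1) => (if i = j then (1 : R) else 0) +
          b j * (if (j : ℕ) = n + 1 then c i else if (i : ℕ) = j + 1 then 1 else 0)).submatrix
            Fin.succ (Fin.succAbove (Fin.last n).succ)).det = ∏ l ∈ Finset.range (n + 1), b l := by
        rw [Fin.succ_last, det_of_isUpperTriangular, Finset.prod_range]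
        · refine Finset.prod_congr rfl fun i _ => ?_
          have hi : (i : ℕ) ≠ n + 1 := i.2.ne
          have hi' : i.succ ≠ i.castSucc := by simp [Fin.ext_iff]
          simp [hi, hi']
        · intro i j hij
          have hi : (j : ℕ) ≠ n + 1 := j.2.ne
          have h3 : (j : ℕ) < i := hij
          have hi' : i.succ ≠ j.castSucc := by simp [Fin.ext_iff]; omega
          have hi'' : (i : ℕ) ≠ j := by omega
          simp [hi, hi', hi'']
      rw [h1, h2, ih (fun l => b (l + 1)) (fun l => c (l + 1)), Finset.sum_range_succ' _ (n + 1)]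
      have h4 : ∀ i, ∏ l ∈ Finset.Ico i (n + 1), b (l + 1) =
          ∏ l ∈ Finset.Ico (i + 1) (n + 1 + 1), b l := fun i => Finset.prod_Ico_add' b i (n + 1) 1
      simp only [h4, Nat.add_sub_add_right, Nat.sub_zero, Nat.Ico_zero_eq_range,
        Finset.prod_range_succ _ (n + 1)]
      simp
      ring
    · intro i _
      have hi : (i : ℕ) ≠ n := i.2.ne
      have h0 : (0 : Fin (n + 1 + 1)) ≠ i.castSucc.succ := (Fin.succ_ne_zero _).symm
      simp [hi, h0]

/-- Columns `vⱼ + bⱼ vⱼ₊₁`, where the vector `v_{r+1}` beyond the range is given by the linear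
relation with coefficients `(-1)ᵏ gₖ`. -/
theorem det_shifted_columns {R : Type*} [CommRing R] (r : ℕ) (v : ℕ → Fin (r + 1) → R)
    (b g : ℕ → R) (hg : g 0 = 1)
    (hrel : ∀ i, ∑ k ∈ Finset.range (r + 2), (-1) ^ k * g k * v (r + 1 - k) i = 0) :
    (of fun i j : Fin (r + 1) => v j i + b j * v (j + 1) i).det =
      (of fun i j : Fin (r + 1) => v j i).det *
        ∑ k ∈ Finset.range (r + 2), g k * ∏ l ∈ Finset.Ico (r + 1 - k) (r + 1), b l := by
  have hlast : ∀ i, v (r + 1) i =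
      ∑ l : Fin (r + 1), v l i * ((-1) ^ (r - l) * g (r + 1 - l)) := by
    intro i
    have h := hrel i
    rw [Finset.sum_range_succ', ← Finset.sum_range_reflect, Finset.sum_range] at h
    simp only [pow_zero, hg, one_mul, Nat.sub_zero] at h
    rw [eq_neg_of_add_eq_zero_right h, ← Finset.sum_neg_distrib]
    refine Finset.sum_congr rfl fun l _ => ?_
    have hl := l.2
    rw [show r + 1 - 1 - (l : ℕ) + 1 = r + 1 - l by omega,
      show r + 1 - (r + 1 - (l : ℕ)) = l by omega, show r + 1 - (l : ℕ) = r - l + 1 by omega,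
      pow_succ]
    ring
  have hmul : (of fun i j : Fin (r + 1) => v j i + b j * v (j + 1) i) =
      (of fun i j : Fin (r + 1) => v j i) *
      (of fun i j : Fin (r + 1) => (if i = j then 1 else 0) +
        b j * (if (j : ℕ) = r then (-1) ^ (r - i) * g (r + 1 - i) else
          if (i : ℕ) = j + 1 then 1 else 0)) := by
    ext i j
    rw [mul_apply]
    simp only [of_apply, mul_add, Finset.sum_add_distrib]
    congr 1
    · simp
    · by_cases hj : (j : ℕ) = r
      · simp only [hj, if_true]
        rw [hlast, Finset.mul_sum]
        exact Finset.sum_congr rfl fun l _ => by ring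
      · have hj1 : (j : ℕ) + 1 < r + 1 := by have := j.2; omega
        rw [Finset.sum_eq_single ⟨j + 1, hj1⟩]
        · simp [hj]; ring
        · intro l _ hl
          have : (l : ℕ) ≠ j + 1 := fun h => hl (Fin.ext h)
          simp [hj, this]
        · simp
  rw [hmul, det_mul, det_one_add_shift r b (fun i => (-1) ^ (r - i) * g (r + 1 - i))]
  congr 1
  rw [Finset.sum_range_succ' (fun k => g k * ∏ l ∈ Finset.Ico (r + 1 - k) (r + 1), b l) (r + 1),
    ← Finset.sum_range_reflect (fun k => g (k + 1) * _) (r + 1), add_comm]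
  congr 1
  · refine Finset.sum_congr rfl fun i hi => ?_
    have hi := Finset.mem_range.1 hi
    rw [show r + 1 - 1 - i + 1 = r + 1 - i by omega, show r + 1 - (r + 1 - i) = i by omega,
      ← mul_assoc ((-1) ^ (r - i)), ← pow_add, ← two_mul, pow_mul, neg_one_sq, one_pow, one_mul]
  · simp [hg]

/-- The truncated differences multiply to a falling factorial, also when some of them vanish. -/
theorem prod_Ico_shift_coeff (c : ℝ) (ns r k : ℕ) (hk : k ≤ r + 1) :
    ∏ l ∈ Finset.Ico (r + 1 - k) (r + 1), c * ((ns + l - r : ℕ) : ℝ) =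
      c ^ k * ns.descFactorial k := by
  rw [Nat.descFactorial_eq_prod_range, Finset.prod_Ico_eq_prod_range,
    show r + 1 - (r + 1 - k) = k by omega, ← Finset.prod_range_reflect, Finset.prod_mul_distrib,
    Finset.prod_const, Finset.card_range, Nat.cast_prod]
  congr 1
  refine Finset.prod_congr rfl fun t ht => ?_
  have := Finset.mem_range.1 ht
  congr 1
  omega

/-- The Hankel determinant of the moments of `sᵈ e⁻ˢ`, by Vandermonde's convolution, which factors
the matrix of binomial coefficients `(d + i + j choose j)` as lower times upper triangular. -/
theorem det_factorial_hankel (d r : ℕ) :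
    (of fun i j : Fin (r + 1) => (((d + i + j).factorial : ℕ) : ℝ)).det =
      ∏ i ∈ Finset.range (r + 1), ((i.factorial : ℝ) * (d + i).factorial) := by
  set Lo : Matrix (Fin (r + 1)) (Fin (r + 1)) ℝ := of fun i k => ((i : ℕ).choose k : ℝ) with hLo
  set Up : Matrix (Fin (r + 1)) (Fin (r + 1)) ℝ := of fun k j =>
    if (k : ℕ) ≤ j then ((d + j).choose (j - k) : ℝ) else 0 with hUp
  have hfac : (of fun i j : Fin (r + 1) => (((d + i + j).factorial : ℕ) : ℝ)) =
      diagonal (fun i : Fin (r + 1) => ((d + i).factorial : ℝ)) * (Lo * Up) *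
        diagonal (fun j : Fin (r + 1) => ((j : ℕ).factorial : ℝ)) := by
    ext i j
    rw [mul_diagonal, diagonal_mul, mul_apply]
    have hV : ∑ k, Lo i k * Up k j = ((d + i + j).choose j : ℝ) := by
      rw [show d + (i : ℕ) + j = i + (d + j) by ring, Nat.add_choose_eq,
        Finset.Nat.sum_antidiagonal_eq_sum_range_succ_mk]
      simp only [hLo, hUp, of_apply]
      push_cast
      rw [← Finset.sum_range (fun k => ((i : ℕ).choose k : ℝ) *
        (if k ≤ (j : ℕ) then ((d + j).choose (j - k) : ℝ) else 0))]
      rw [← Finset.sum_subset (Finset.range_mono (show (j : ℕ) + 1 ≤ r + 1 from j.2))]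
      · refine Finset.sum_congr rfl fun k hk => ?_
        rw [if_pos (by have := Finset.mem_range.1 hk; omega)]
      · intro k _ hk
        rw [if_neg (by rw [Finset.mem_range] at hk; omega), mul_zero]
    rw [hV, of_apply]
    have := Nat.add_choose_mul_factorial_mul_factorial (d + i) j
    rw [← this]
    push_cast
    ring
  rw [hfac, det_mul, det_mul, det_mul, det_diagonal, det_diagonal, det_of_isLowerTriangular,
    det_of_isUpperTriangular, Finset.prod_mul_distrib, Finset.prod_range, Finset.prod_range]
  · simp [hLo, hUp, mul_comm]
  · intro i j hij
    have : ¬ (i : ℕ) ≤ j := not_le.2 hij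
    simp only [hUp, of_apply, if_neg this]
  · intro i j hij
    have : (i : ℕ) < j := hij
    simp [hLo, Nat.choose_eq_zero_of_lt this]

theorem constK_eq (d r : ℕ) :
    constK (d + (r + 1)) (r + 1) =
      (∏ i ∈ Finset.range (r + 1), ((i.factorial : ℝ) * (d + i).factorial))⁻¹ := by
  rw [constK, ← Finset.Ico_succ_right_eq_Icc, Finset.prod_Ico_eq_prod_range,
    ← Finset.prod_range_reflect]
  congr 1
  refine Finset.prod_congr rfl fun i hi => ?_
  have hi := Finset.mem_range.1 hi
  have e : ((1 + (r + 1 + 1 - 1 - 1 - i) : ℕ) : ℝ) = r + 1 - i := by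
    rw [show 1 + (r + 1 + 1 - 1 - 1 - i) = r + 1 - i by omega, Nat.cast_sub hi.le]
    push_cast; ring
  rw [Order.succ_eq_add_one, e]
  rw [← Real.Gamma_nat_eq_factorial, ← Real.Gamma_nat_eq_factorial]
  push_cast
  congr 2 <;> ring

/-- `∫₀^∞ s^{d+t} e⁻ˢ (1 + as)^{2r-t} ds`, the moment of order `t` of `β = s / (1 + as)` under the
weight `sᵈ e⁻ˢ (1 + as)²ʳ`; the order `t = 2r + 1` does occur. -/
noncomputable def betaMoment (a : ℝ) (d r t : ℕ) : ℝ :=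
  ∫ s in Set.Ioi (0 : ℝ), s ^ (d + t) * Real.exp (-s) * (1 + a * s) ^ (2 * r) / (1 + a * s) ^ t

variable {a : ℝ}

theorem integrableOn_betaMoment (ha : 0 ≤ a) (d r t : ℕ) :
    IntegrableOn (fun s : ℝ => s ^ (d + t) * Real.exp (-s) * (1 + a * s) ^ (2 * r) /
      (1 + a * s) ^ t) (Set.Ioi 0) := by
  have e : ∀ s : ℝ, s ^ (d + t) * Real.exp (-s) * (1 + a * s) ^ (2 * r) / (1 + a * s) ^ t =
      ∑ i ∈ Finset.range (2 * r + 1), ((2 * r).choose i * a ^ i) *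
        (s ^ (d + t + i) * Real.exp (-s) / (1 + a * s) ^ t) := by
    intro s
    have : (1 + a * s) ^ (2 * r) = ∑ i ∈ Finset.range (2 * r + 1),
        (a * s) ^ i * 1 ^ (2 * r - i) * (2 * r).choose i := by rw [add_comm, add_pow]
    rw [this]
    simp only [Finset.mul_sum, Finset.sum_div]
    exact Finset.sum_congr rfl fun i _ => by ring
  simp only [e]
  exact integrable_finsetSum _ fun i _ => (integrableOn_lagInt ha _ _).const_mul _

/-- The entries are the Gram matrix of the polynomials `sⁱ (1 + as)ʳ⁻ⁱ` for the weight `sᵈ e⁻ˢ`,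
and these are related to the monomials by a unitriangular matrix. -/
theorem det_betaMoment (ha : 0 ≤ a) (d r : ℕ) :
    (of fun i j : Fin (r + 1) => betaMoment a d r (i + j)).det =
      ∏ i ∈ Finset.range (r + 1), ((i.factorial : ℝ) * (d + i).factorial) := by
  set P : Matrix (Fin (r + 1)) (Fin (r + 1)) ℝ := of fun i u =>
    if (i : ℕ) ≤ u then ((r - i).choose (u - i) : ℝ) * a ^ ((u : ℕ) - i) else 0 with hP
  have hbasis : ∀ (i : Fin (r + 1)) (s : ℝ), s ^ (i : ℕ) * (1 + a * s) ^ (r - i) =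
      ∑ u, P i u * s ^ (u : ℕ) := by
    intro i s
    have hi := i.2
    simp only [hP, of_apply]
    rw [add_comm 1 (a * s), add_pow, Finset.mul_sum, ← Finset.sum_range (fun u =>
      (if (i : ℕ) ≤ u then ((r - i).choose (u - i) : ℝ) * a ^ (u - (i : ℕ)) else 0) * s ^ u),
      ← Finset.sum_range_add_sum_Ico _ hi.le,
      Finset.sum_eq_zero (s := Finset.range (i : ℕ)), zero_add,
      Finset.sum_Ico_eq_sum_range, show r + 1 - (i : ℕ) = r - i + 1 by omega]
    · refine Finset.sum_congr rfl fun k _ => ?_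
      rw [if_pos (by omega), Nat.add_sub_cancel_left]
      ring
    · intro u hu
      rw [if_neg (by rw [Finset.mem_range] at hu; omega), zero_mul]
  have hV : (of fun i j : Fin (r + 1) => betaMoment a d r (i + j)) =
      P * (of fun i j : Fin (r + 1) => (((d + i + j).factorial : ℕ) : ℝ)) * Pᵀ := by
    ext i j
    rw [of_apply, betaMoment]
    have e : ∀ s ∈ Set.Ioi (0 : ℝ), s ^ (d + ((i : ℕ) + j)) * Real.exp (-s) *
        (1 + a * s) ^ (2 * r) / (1 + a * s) ^ ((i : ℕ) + j) =
        ∑ w, ∑ u, (P i u * P j w) * (s ^ (d + (u : ℕ) + w) * Real.exp (-s) /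
          (1 + a * s) ^ 0) := by
      intro s hs
      have hs0 : (0 : ℝ) < s := hs
      have h1 : 1 + a * s ≠ 0 := by positivity
      have hi := i.2
      have hj := j.2
      calc _ = s ^ d * Real.exp (-s) * (∑ u, P i u * s ^ (u : ℕ)) * (∑ w, P j w * s ^ (w : ℕ)) := by
            rw [← hbasis, ← hbasis, div_eq_iff (pow_ne_zero _ h1),
              show 2 * r = (r - i) + (r - j) + (i + j) by omega]
            ring
        _ = _ := by
            rw [mul_assoc, Finset.sum_mul_sum, Finset.sum_comm, Finset.mul_sum]
            refine Finset.sum_congr rfl fun w _ => ?_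
            rw [Finset.mul_sum]
            exact Finset.sum_congr rfl fun u _ => by ring
    rw [setIntegral_congr_fun measurableSet_Ioi e, integral_finsetSum _ fun w _ =>
      integrable_finsetSum _ fun u _ => (integrableOn_lagInt ha _ _).const_mul _, mul_apply]
    refine Finset.sum_congr rfl fun w _ => ?_
    rw [integral_finsetSum _ fun u _ => (integrableOn_lagInt ha _ _).const_mul _, mul_apply,
      Finset.sum_mul]
    refine Finset.sum_congr rfl fun u _ => ?_
    rw [integral_const_mul, ← lagInt, lagInt_zero_right, transpose_apply, of_apply]
    ring
  have hdetP : P.det = 1 := by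
    rw [det_of_isUpperTriangular]
    · simp [hP]
    · intro i j hij
      have : ¬ (i : ℕ) ≤ j := not_le.2 hij
      simp only [hP, of_apply, if_neg this]
  rw [hV, det_mul, det_mul, det_transpose, hdetP, one_mul, mul_one, det_factorial_hankel]

/-- The orthogonality of the averaged ratio as a linear relation between the columns of moments. -/
theorem sum_neg_one_pow_mul_betaMoment (ha : 0 < a) {d r : ℕ} {g : ℕ → ℝ}
    (hg : ∀ x, ∑ k ∈ Finset.range (r + 2), g k * x ^ k = ratioPoly a r (d + r + 1) (a + x))
    {i : ℕ} (hi : i ≤ r) :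
    ∑ k ∈ Finset.range (r + 2), (-1) ^ k * g k * betaMoment a d r (i + (r + 1 - k)) = 0 := by
  rw [← integral_pow_mul_ratioPoly_eq_zero ha (p := d + r + 1) (by omega) hi]
  simp only [betaMoment, ← integral_const_mul]
  rw [← integral_finsetSum _ fun k _ => (integrableOn_betaMoment ha.le _ _ _).const_mul _]
  refine setIntegral_congr_fun measurableSet_Ioi fun s hs => ?_
  have hs0 : (0 : ℝ) < s := hs
  have h1 : 1 + a * s ≠ 0 := by positivity
  have h2 : ratioPoly a r (d + r + 1) (-s⁻¹) =
      ∑ k ∈ Finset.range (r + 2), g k * (-((1 + a * s) / s)) ^ k := by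
    rw [hg]
    congr 1
    field_simp
    ring
  simp only [h2, Finset.mul_sum, Finset.sum_mul, Finset.sum_div]
  refine Finset.sum_congr rfl fun k hk => ?_
  have hk := Finset.mem_range.1 hk
  obtain ⟨l, hl⟩ : ∃ l, r + 1 = k + l := ⟨r + 1 - k, by omega⟩
  have h3 : (1 + a * s) ^ (2 * r) / (1 + a * s) ^ (i + l) =
      (1 + a * s) ^ (r - i) * (1 + a * s) ^ k / (1 + a * s) := by
    rw [div_eq_div_iff (pow_ne_zero _ h1) h1, ← pow_succ, ← pow_add, ← pow_add]
    congr 1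
    omega
  have h4 : s ^ (d + (i + l)) = s ^ i * (s ^ (d + (k + l)) / s ^ k) := by
    rw [← mul_div_assoc, eq_div_iff (pow_ne_zero _ hs0.ne')]
    ring
  rw [show r + 1 - k = l by omega, neg_pow ((1 + a * s) / s), div_pow,
    show d + r + 1 = d + (k + l) by omega, mul_div_assoc (_ * Real.exp (-s)), h3, h4]
  ring

/-- The entries of `Ξ̄` in terms of the moments, by the substitution `x = as`. -/
theorem rpow_mul_vartheta (ha : 0 < a) (d r t : ℕ) :
    a ^ (-((d : ℝ) + t + 1)) * vartheta (d + (r + 1)) (r + 1) ((d : ℝ) + t + 1) a =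
      betaMoment a d r t := by
  have hΓ : Real.Gamma ((d : ℝ) + t + 1) ≠ 0 := (Real.Gamma_pos_of_pos (by positivity)).ne'
  rw [vartheta, tricomiU, mul_inv_cancel_left₀ hΓ]
  have h := integral_comp_mul_left_Ioi (fun x : ℝ => Real.exp (-(1 / a * x)) *
    x ^ ((d : ℝ) + t + 1 - 1) *
    (1 + x) ^ (((d + (r + 1) : ℕ) : ℝ) + ((r + 1 : ℕ) : ℝ) - ((d : ℝ) + t + 1) - 1)) 0 ha
  rw [mul_zero, smul_eq_mul, ← inv_mul_eq_iff_eq_mul₀ (inv_ne_zero ha.ne'), inv_inv] at h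
  rw [← h, betaMoment, ← mul_assoc, ← integral_const_mul]
  refine setIntegral_congr_fun measurableSet_Ioi fun s hs => ?_
  have hs0 : (0 : ℝ) < s := hs
  have h1 : 0 < 1 + a * s := by positivity
  have e1 : ((d + (r + 1) : ℕ) : ℝ) + ((r + 1 : ℕ) : ℝ) - ((d : ℝ) + t + 1) - 1 =
      ((2 * r : ℕ) : ℝ) - (t : ℕ) := by push_cast; ring
  have e2 : (d : ℝ) + t + 1 - 1 = ((d + t : ℕ) : ℝ) := by push_cast; ring
  have e3 : -((d : ℝ) + t + 1) = -((d + t + 1 : ℕ) : ℝ) := by push_cast; ring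
  have e4 : 1 / a * (a * s) = s := by field_simp
  rw [e1, e2, e3, e4, Real.rpow_neg ha.le, Real.rpow_natCast, Real.rpow_sub h1,
    Real.rpow_natCast, Real.rpow_natCast, Real.rpow_natCast, mul_pow]
  field_simp
  ring

/-- Both cases of the definition of `Ξ̄` are covered by the truncated subtraction `ns + j - r`,
which vanishes exactly in the first case. -/
theorem xiBar_eq (ha : 0 < a) (d r ns : ℕ) (ρ : ℝ) :
    xiBar (d + (r + 1)) (r + 1) ns ρ a = of fun i j : Fin (r + 1) =>
      betaMoment a d r (i + j) + (ρ * a / ns * ((ns + j - r : ℕ) : ℝ)) *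
        betaMoment a d r (i + (j + 1)) := by
  ext i j
  rw [xiBar, of_apply, of_apply, ← rpow_mul_vartheta ha, ← rpow_mul_vartheta ha, xiBarEntry]
  have e1 : (1 : ℝ) - (((d + (r + 1) : ℕ) : ℝ) - ((r + 1 : ℕ) : ℝ) + ((i + 1 : ℕ) : ℝ) +
      ((j + 1 : ℕ) : ℝ)) = -((d : ℝ) + ((i + j : ℕ) : ℝ) + 1) := by push_cast; ring
  have e2 : ((d + (r + 1) : ℕ) : ℝ) - ((r + 1 : ℕ) : ℝ) + ((i + 1 : ℕ) : ℝ) +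
      ((j + 1 : ℕ) : ℝ) - 1 = (d : ℝ) + ((i + j : ℕ) : ℝ) + 1 := by push_cast; ring
  have e3 : ((d + (r + 1) : ℕ) : ℝ) - ((r + 1 : ℕ) : ℝ) + ((i + 1 : ℕ) : ℝ) +
      ((j + 1 : ℕ) : ℝ) = (d : ℝ) + ((i + (j + 1) : ℕ) : ℝ) + 1 := by push_cast; ring
  have e4 : a ^ (-((d : ℝ) + ((i + (j + 1) : ℕ) : ℝ) + 1)) =
      a ^ (-((d : ℝ) + ((i + j : ℕ) : ℝ) + 1)) * a⁻¹ := by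
    rw [← Real.rpow_neg_one a, ← Real.rpow_add ha]
    congr 1
    push_cast
    ring
  simp only [e1, e2]
  rw [e3, e4]
  split_ifs with hc
  · have : ns + (j : ℕ) - r = 0 := by omega
    rw [this]
    simp
  · have h : r ≤ ns + j := by omega
    rw [Nat.cast_sub h]
    push_cast
    field_simp
    ring

/-- The determinant of `Ξ̄` in terms of the coefficients of the averaged ratio. -/
theorem constK_mul_det_xiBar (ha : 0 < a) {d r : ℕ} (ns : ℕ) (ρ : ℝ) {g : ℕ → ℝ} (hg0 : g 0 = 1)
    (hg : ∀ x, ∑ k ∈ Finset.range (r + 2), g k * x ^ k = ratioPoly a r (d + r + 1) (a + x)) :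
    constK (d + (r + 1)) (r + 1) * (xiBar (d + (r + 1)) (r + 1) ns ρ a).det =
      ∑ k ∈ Finset.range (r + 2), (ρ * a / ns) ^ k * ns.descFactorial k * g k := by
  have hdet := det_shifted_columns r (fun j i => betaMoment a d r (i + j))
    (fun l => ρ * a / ns * ((ns + l - r : ℕ) : ℝ)) g hg0
    (fun i => sum_neg_one_pow_mul_betaMoment ha hg (Nat.lt_succ_iff.1 i.2))
  have hne : ∏ i ∈ Finset.range (r + 1), ((i.factorial : ℝ) * (d + i).factorial) ≠ 0 :=
    Finset.prod_ne_zero_iff.2 fun i _ => by positivity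
  rw [xiBar_eq ha, hdet, det_betaMoment ha.le, constK_eq, inv_mul_cancel_left₀ hne]
  refine Finset.sum_congr rfl fun k hk => ?_
  rw [prod_Ico_shift_coeff _ _ _ _ (by have := Finset.mem_range.1 hk; omega), mul_comm]

end Determinants

/-! ### Singular values and their measurability -/

section SingularValues

open Matrix

/-- The singular values squared are the eigenvalues of `Hᴴ H`, with multiplicity. -/
theorem det_one_add_smul_eq_prod_singularValues {r c : ℕ} (H : Matrix (Fin r) (Fin c) ℂ) (t : ℂ) :
    (1 + t • (Hᴴ * H)).det =
      ∏ i ∈ Finset.range c, (1 + t * ((toEuclideanLin H).singularValues i : ℂ) ^ 2) := by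
  set T := toEuclideanLin H with hT
  have hn : Module.finrank ℂ (EuclideanSpace ℂ (Fin c)) = c := finrank_euclideanSpace_fin
  have hS := T.isSymmetric_adjoint_comp_self
  set b := (hS.eigenvectorBasis hn).toBasis with hb
  have h1 : LinearMap.det (1 + t • (T.adjoint ∘ₗ T)) = (1 + t • (Hᴴ * H)).det := by
    have hT' : T.adjoint ∘ₗ T = toEuclideanLin (Hᴴ * H) := by
      rw [hT, ← toEuclideanLin_conjTranspose_eq_adjoint]
      exact (toLpLin_mul 2 2 2 Hᴴ H).symm
    have : (1 + t • (T.adjoint ∘ₗ T)) =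
        toLin (PiLp.basisFun 2 ℂ (Fin c)) (PiLp.basisFun 2 ℂ (Fin c)) (1 + t • (Hᴴ * H)) := by
      rw [map_add, map_smul, toLin_one, hT']
      rfl
    rw [this, LinearMap.det_toLin]
  have h2 : LinearMap.det (1 + t • (T.adjoint ∘ₗ T)) =
      ∏ i : Fin c, (1 + t * ((T.singularValues i : ℝ) : ℂ) ^ 2) := by
    rw [← LinearMap.det_toMatrix b, map_add, map_smul, LinearMap.toMatrix_one,
      hb, LinearMap.IsSymmetric.toMatrix_eigenvectorBasis]
    rw [← diagonal_one, ← diagonal_smul, diagonal_add, det_diagonal]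
    refine Finset.prod_congr rfl fun i _ => ?_
    have := T.sq_singularValues_fin hn i
    simp only [Pi.smul_apply, Function.comp_apply, smul_eq_mul, ← this]
    push_cast
    rfl
  rw [← h1, h2, Finset.prod_range (fun i => (1 + t * ((T.singularValues i : ℝ) : ℂ) ^ 2))]

theorem prod_one_add_mul_sq_incSingularValue {r c : ℕ} (H : Matrix (Fin r) (Fin c) ℂ) (t : ℂ) :
    ∏ i, (1 + t * (incSingularValue H i : ℂ) ^ 2) = (1 + t • (H * Hᴴ)).det := by
  rw [← Matrix.smul_mul, det_one_add_mul_comm, Matrix.mul_smul,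
    det_one_add_smul_eq_prod_singularValues]
  have h1 : ∏ i, (1 + t * (incSingularValue H i : ℂ) ^ 2) = ∏ i ∈ Finset.range (min r c),
      (1 + t * ((toEuclideanLin H).singularValues i : ℂ) ^ 2) := by
    rw [Finset.prod_range]
    exact Fintype.prod_equiv Fin.revPerm _ _ fun i => rfl
  rw [h1]
  -- the singular values of index at least the rank vanish
  refine Finset.prod_subset (Finset.range_mono (min_le_right r c)) fun i hi hi' => ?_
  have hri : r ≤ i := by
    simp only [Finset.mem_range] at hi hi'
    omega
  have hle : Module.finrank ℂ (LinearMap.range (toEuclideanLin H)) ≤ i :=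
    ((Submodule.finrank_le _).trans_eq finrank_euclideanSpace_fin).trans hri
  rw [(LinearMap.singularValues_eq_zero_iff_le_finrank_range (toEuclideanLin H)).2 hle]
  simp

theorem incSingularValue_nonneg {r c : ℕ} (H : Matrix (Fin r) (Fin c) ℂ) (i : Fin (min r c)) :
    0 ≤ incSingularValue H i := LinearMap.singularValues_nonneg _ _

theorem monotone_sq_incSingularValue {r c : ℕ} (H : Matrix (Fin r) (Fin c) ℂ) :
    Monotone fun i => incSingularValue H i ^ 2 := fun i j hij =>
  pow_le_pow_left₀ (incSingularValue_nonneg H i)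
    ((toEuclideanLin H).singularValues_antitone (by
      have : j.rev ≤ i.rev := Fin.rev_le_rev.2 hij
      exact this)) 2

/-- Increasing tuples are separated by the values of `∏ᵢ (1 + n xᵢ)` at the positive integers. -/
theorem injective_prod_one_add_mul (q : ℕ) :
    Function.Injective fun (x : {x : Fin q → ℝ // Monotone x}) (n : ℕ) =>
      ∏ i, (1 + ((n : ℝ) + 1) * x.1 i) := by
  rintro ⟨x, hx⟩ ⟨y, hy⟩ h
  have hev : ∀ (x : Fin q → ℝ) (n : ℕ), (∏ i, (Polynomial.X - Polynomial.C (x i))).eval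
      (-(1 / ((n : ℝ) + 1))) = (-(1 / ((n : ℝ) + 1))) ^ q * ∏ i, (1 + ((n : ℝ) + 1) * x i) := by
    intro x n
    rw [Polynomial.eval_prod]
    have hn : (n : ℝ) + 1 ≠ 0 := by positivity
    rw [show (-(1 / ((n : ℝ) + 1))) ^ q = ∏ _i : Fin q, (-(1 / ((n : ℝ) + 1))) by simp,
      ← Finset.prod_mul_distrib]
    refine Finset.prod_congr rfl fun i _ => ?_
    simp only [Polynomial.eval_sub, Polynomial.eval_X, Polynomial.eval_C]
    field_simp
    ring
  have hpoly : (∏ i, (Polynomial.X - Polynomial.C (x i))) =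
      ∏ i, (Polynomial.X - Polynomial.C (y i)) := by
    refine Polynomial.eq_of_infinite_eval_eq _ _ (Set.Infinite.mono ?_
      (Set.infinite_range_of_injective (f := fun n : ℕ => -(1 / ((n : ℝ) + 1))) ?_))
    · rintro _ ⟨n, rfl⟩
      change Polynomial.eval _ _ = Polynomial.eval _ _
      rw [hev, hev]
      exact congrArg _ (congrFun h n)
    · intro m n hmn
      have := neg_injective hmn
      simpa using this
  have hroots := congrArg Polynomial.roots hpoly
  have hr : ∀ x : Fin q → ℝ, (∏ i, (Polynomial.X - Polynomial.C (x i))).roots =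
      Multiset.map x Finset.univ.val := by
    intro x
    rw [Polynomial.roots_prod _ _ (Finset.prod_ne_zero_iff.2 fun i _ =>
      Polynomial.X_sub_C_ne_zero _)]
    simp
  rw [hr, hr, Fin.univ_val_map, Fin.univ_val_map] at hroots
  exact Subtype.ext (List.ofFn_injective (List.Perm.eq_of_sortedLE hx.sortedLE_ofFn
    hy.sortedLE_ofFn (Multiset.coe_eq_coe.1 hroots)))

/-- The ordered singular values are measurable functions of the entries: their symmetric functions
are, and an injective measurable map between standard Borel spaces has a measurable inverse. -/
theorem measurable_sq_incSingularValue (r c : ℕ) :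
    Measurable fun (H : Fin r → Fin c → ℂ) (i : Fin (min r c)) =>
      incSingularValue (Matrix.of H) i ^ 2 := by
  have hclosed : IsClosed {x : Fin (min r c) → ℝ | Monotone x} := by
    simp only [Monotone, Set.ofPred_forall]
    refine isClosed_iInter fun i => isClosed_iInter fun j => isClosed_iInter fun _ => ?_
    exact isClosed_le (continuous_apply i) (continuous_apply j)
  have : StandardBorelSpace {x : Fin (min r c) → ℝ // Monotone x} :=
    hclosed.measurableSet.standardBorel
  have hemb : MeasurableEmbedding fun (x : {x : Fin (min r c) → ℝ // Monotone x}) (n : ℕ) =>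
      ∏ i, (1 + ((n : ℝ) + 1) * x.1 i) := by
    refine Measurable.measurableEmbedding ?_ (injective_prod_one_add_mul _)
    refine measurable_pi_lambda _ fun n => Finset.measurable_prod _ fun i _ => ?_
    have : Measurable fun x : {x : Fin (min r c) → ℝ // Monotone x} => x.1 i :=
      (measurable_pi_apply i).comp measurable_subtype_coe
    exact (this.const_mul _).const_add _
  have hmeas : Measurable fun H : Fin r → Fin c → ℂ =>
      (⟨fun i => incSingularValue (Matrix.of H) i ^ 2, monotone_sq_incSingularValue _⟩ :
        {x : Fin (min r c) → ℝ // Monotone x}) := by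
    rw [← hemb.measurable_comp_iff]
    refine measurable_pi_lambda _ fun n => ?_
    have e : ∀ H : Fin r → Fin c → ℂ, ∏ i, (1 + ((n : ℝ) + 1) *
        incSingularValue (Matrix.of H) i ^ 2) =
        ((1 + ((n : ℂ) + 1) • (Matrix.of H * (Matrix.of H)ᴴ)).det).re := by
      intro H
      rw [← prod_one_add_mul_sq_incSingularValue, ← Complex.ofReal_re (∏ i, _)]
      push_cast
      rfl
    simp only [Function.comp_def, e]
    refine Complex.measurable_re.comp ?_
    simp only [det_apply, Matrix.add_apply, Matrix.smul_apply, Matrix.mul_apply, of_apply,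
      conjTranspose_apply]
    fun_prop
  exact measurable_subtype_coe.comp hmeas

end SingularValues

/-! ### Random matrices with Gaussian entries -/

section GaussianMatrix

variable {Ω : Type*} [MeasurableSpace Ω] {μ : Measure Ω} {r c : ℕ}
  {H : Ω → Matrix (Fin r) (Fin c) ℂ}

theorem IsStdComplexGaussianMatrix.transpose (hH : IsStdComplexGaussianMatrix H μ) :
    IsStdComplexGaussianMatrix (fun ω => (H ω)ᵀ) μ where
  hasLaw_entry i j := hH.hasLaw_entry j i
  iIndepFun_entry := hH.iIndepFun_entry.precomp Prod.swap_injective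

/-- The rows of a standard complex Gaussian matrix are independent standard Gaussian vectors. -/
theorem IsStdComplexGaussianMatrix.hasLaw [IsProbabilityMeasure μ]
    (hH : IsStdComplexGaussianMatrix H μ) :
    HasLaw (fun ω i j => H ω i j)
      (Measure.pi fun _ : Fin r => Measure.pi fun _ : Fin c => stdComplexGaussian) μ where
  aemeasurable := aemeasurable_pi_lambda _ fun i => aemeasurable_pi_lambda _ fun j =>
    (hH.hasLaw_entry i j).aemeasurable
  map_eq := by
    have h1 := (iIndepFun_iff_map_fun_eq_pi_map
      fun ij : Fin r × Fin c => (hH.hasLaw_entry ij.1 ij.2).aemeasurable).1 hH.iIndepFun_entry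
    simp only [(hH.hasLaw_entry _ _).map_eq] at h1
    have h2 := Measure.infinitePi_map_curry fun (_ : Fin r) (_ : Fin c) => stdComplexGaussian
    simp only [Measure.infinitePi_eq_pi] at h2
    rw [← h2, ← h1, AEMeasurable.map_map_of_aemeasurable]
    · rfl
    · exact (MeasurableEquiv.measurable _).aemeasurable
    · exact aemeasurable_pi_lambda _ fun ij => (hH.hasLaw_entry ij.1 ij.2).aemeasurable

end GaussianMatrix

section BetaGenerating

open Matrix Polynomial

theorem descCoeffSum_X_pow (n k : ℕ) : descCoeffSum n (X ^ k) = n.descFactorial k := by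
  rw [descCoeffSum_apply]
  simp only [coeff_X_pow, mul_ite, mul_one, mul_zero, Finset.sum_ite_eq', Finset.mem_range]
  split_ifs with h
  · rfl
  · rw [Nat.descFactorial_eq_zero_iff_lt.2 (by omega), Nat.cast_zero]

theorem sum_vecMulVec_star_eq {m n : Type*} [Fintype m] (G : n → m → ℂ) [Fintype n] :
    ∑ l, vecMulVec (G l) (star (G l)) = (of G)ᵀ * ((of G)ᵀ)ᴴ := by
  ext i j
  simp [Matrix.sum_apply, vecMulVec_apply, Matrix.mul_apply]

theorem integral_det_ratio_eq_ratioPoly {a : ℝ} (ha : 0 ≤ a) (y : ℝ) (r n : ℕ) :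
    ∫ H : Fin n → Fin (r + 1) → ℂ, (1 + (y : ℂ) • ∑ l, vecMulVec (H l) (star (H l))).det /
        (1 + (a : ℂ) • ∑ l, vecMulVec (H l) (star (H l))).det
      ∂(Measure.pi fun _ => Measure.pi fun _ : Fin (r + 1) => stdComplexGaussian) =
    (ratioPoly a r n y : ℂ) := by
  have e1 : (1 + C (y : ℂ) * X) ^ r =
      ∑ k ∈ Finset.range (r + 1), ((r.choose k : ℂ) * (y : ℂ) ^ k) • (X ^ k : ℂ[X]) := by
    rw [add_comm, add_pow]
    refine Finset.sum_congr rfl fun k _ => ?_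
    simp only [one_pow, mul_one, mul_pow, smul_eq_C_mul, C_mul, C_pow, map_natCast]
    ring
  have e2 : C (y : ℂ) * X * (1 + C (y : ℂ) * X) ^ r =
      ∑ k ∈ Finset.range (r + 1),
        ((r.choose k : ℂ) * (y : ℂ) ^ (k + 1)) • (X ^ (k + 1) : ℂ[X]) := by
    rw [e1, Finset.mul_sum]
    refine Finset.sum_congr rfl fun k _ => ?_
    simp only [smul_eq_C_mul, C_mul, C_pow]
    ring
  rw [integral_det_ratio ha, Fintype.card_fin, Nat.add_sub_cancel, e2, e1]
  simp only [map_sum, map_smul, descCoeffSum_X_pow, ratioPoly, smul_eq_mul]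
  push_cast
  congr 2 <;> exact Finset.sum_congr rfl fun k _ => by ring

theorem betaVal_nonneg {a : ℝ} (ha : 0 < a) {r c : ℕ} (H : Matrix (Fin r) (Fin c) ℂ)
    (i : Fin (min r c)) : 0 ≤ betaVal a H i := by
  unfold betaVal; positivity

theorem betaVal_le {a : ℝ} (ha : 0 < a) {r c : ℕ} (H : Matrix (Fin r) (Fin c) ℂ)
    (i : Fin (min r c)) : betaVal a H i ≤ a⁻¹ := by
  unfold betaVal
  rw [div_le_iff₀ (by positivity), mul_add, ← mul_assoc, inv_mul_cancel₀ ha.ne']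
  have : 0 < a⁻¹ := inv_pos.2 ha
  linarith

/-- The generating function of the `βᵢ` is a ratio of two characteristic determinants of the
Wishart matrix `H Hᴴ`. -/
theorem prod_one_add_mul_betaVal {a : ℝ} (ha : 0 < a) {r c : ℕ} (H : Matrix (Fin r) (Fin c) ℂ)
    (x : ℝ) : ((∏ i, (1 + x * betaVal a H i) : ℝ) : ℂ) =
      (1 + ((a + x : ℝ) : ℂ) • (H * Hᴴ)).det / (1 + (a : ℂ) • (H * Hᴴ)).det := by
  rw [← prod_one_add_mul_sq_incSingularValue, ← prod_one_add_mul_sq_incSingularValue,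
    ← Finset.prod_div_distrib]
  push_cast
  refine Finset.prod_congr rfl fun i _ => ?_
  have h : ((1 + a * incSingularValue H i ^ 2 : ℝ) : ℂ) ≠ 0 := by
    exact_mod_cast (show (1 + a * incSingularValue H i ^ 2 : ℝ) ≠ 0 by positivity)
  push_cast at h
  rw [betaVal, eq_div_iff h]
  push_cast
  rw [add_mul, mul_assoc, div_mul_cancel₀ _ h]
  ring

theorem det_one_add_smul_transpose_mul {r c : ℕ} (H : Matrix (Fin r) (Fin c) ℂ) (t : ℂ) :
    (1 + t • (Hᵀ * (Hᵀ)ᴴ)).det = (1 + t • (H * Hᴴ)).det := by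
  rw [← Matrix.smul_mul t H, det_one_add_mul_comm, Matrix.mul_smul, ← det_transpose]
  congr 1
  rw [transpose_add, transpose_smul, transpose_mul, transpose_one]
  rfl

variable {Ω : Type*} [MeasurableSpace Ω] {μ : Measure Ω} {nd nr : ℕ}
  {H : Ω → Matrix (Fin nd) (Fin nr) ℂ}

theorem IsStdComplexGaussianMatrix.aemeasurable_betaVal [IsProbabilityMeasure μ]
    (hH : IsStdComplexGaussianMatrix H μ) (a : ℝ) :
    AEMeasurable (fun ω => betaVal a (H ω)) μ := by
  have h := (measurable_sq_incSingularValue nd nr).comp_aemeasurable hH.hasLaw.aemeasurable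
  have h2 : ∀ i, AEMeasurable (fun ω => incSingularValue (H ω) i ^ 2) μ := fun i =>
    (measurable_pi_apply i).comp_aemeasurable h
  refine aemeasurable_pi_lambda _ fun i => ?_
  exact (h2 i).div (((h2 i).const_mul a).const_add 1)

/-- Of `H` and its transpose, the one with `min nd nr` columns and `max nd nr` rows is used, so
that the rows of that matrix are the Gaussian vectors of `ratioPoly`. -/
theorem IsStdComplexGaussianMatrix.integral_prod_one_add_mul_betaVal [IsProbabilityMeasure μ]
    (hH : IsStdComplexGaussianMatrix H μ) {a : ℝ} (ha : 0 < a) {r p : ℕ}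
    (hmin : min nd nr = r + 1) (hmax : max nd nr = p) (x : ℝ) :
    ∫ ω, ∏ i, (1 + x * betaVal a (H ω) i) ∂μ = ratioPoly a r p (a + x) := by
  apply Complex.ofReal_injective
  rw [← integral_det_ratio_eq_ratioPoly ha.le, ← integral_complex_ofReal]
  simp only [prod_one_add_mul_betaVal ha]
  have key : ∀ {s : ℕ} {G : Ω → Matrix (Fin p) (Fin s) ℂ}, IsStdComplexGaussianMatrix G μ →
      s = r + 1 → (∀ ω (t : ℂ), (1 + t • ((G ω)ᵀ * ((G ω)ᵀ)ᴴ)).det =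
        (1 + t • (H ω * (H ω)ᴴ)).det) →
      ∫ ω, (1 + ((a + x : ℝ) : ℂ) • (H ω * (H ω)ᴴ)).det /
        (1 + (a : ℂ) • (H ω * (H ω)ᴴ)).det ∂μ =
      ∫ H : Fin p → Fin (r + 1) → ℂ,
        (1 + ((a + x : ℝ) : ℂ) • ∑ l, vecMulVec (H l) (star (H l))).det /
        (1 + (a : ℂ) • ∑ l, vecMulVec (H l) (star (H l))).det
        ∂(Measure.pi fun _ => Measure.pi fun _ : Fin (r + 1) => stdComplexGaussian) := by
    rintro s G hG rfl hdet
    simp only [sum_vecMulVec_star_eq]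
    rw [← hG.hasLaw.integral_comp]
    · exact integral_congr_ae (.of_forall fun ω => by
        simp only [Function.comp_apply, ← hdet]; rfl)
    · refine Measurable.aestronglyMeasurable ?_
      simp only [det_apply, Matrix.add_apply, Matrix.smul_apply, Matrix.mul_apply, of_apply,
        conjTranspose_apply, transpose_apply]
      fun_prop
  rcases le_total nd nr with h | h
  · rw [min_eq_left h] at hmin
    rw [max_eq_right h] at hmax
    subst hmax
    exact key hH.transpose hmin fun ω t => rfl
  · rw [min_eq_right h] at hmin
    rw [max_eq_left h] at hmax
    subst hmax
    exact key hH hmin fun ω t => det_one_add_smul_transpose_mul _ _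

end BetaGenerating

section PrincipalMinors

open Matrix Polynomial

/-- Expansion of `det (1 + diag d · W)` along the rows that are taken from `diag d · W`. -/
theorem det_one_add_diagonal_mul {m R : Type*} [Fintype m] [DecidableEq m] [CommRing R]
    (d : m → R) (W : Matrix m m R) :
    (1 + diagonal d * W).det =
      ∑ S : Finset m, (∏ i ∈ S, d i) *
        (of fun i j => if i ∈ S then W i j else (1 : Matrix m m R) i j).det := by
  have h : (1 + diagonal d * W).det =
      detRowAlternating.toMultilinearMap ((fun i => d i • W i) + fun i => (1 : Matrix m m R) i) := by
    rw [add_comm]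
    change det _ = det _
    congr 1
    ext i j
    simp [Matrix.diagonal_mul]
  rw [h, MultilinearMap.map_add_univ]
  refine Finset.sum_congr rfl fun S _ => ?_
  have := detRowAlternating.toMultilinearMap.map_piecewise_smul d
    (fun i j => if i ∈ S then W i j else (1 : Matrix m m R) i j) S
  rw [smul_eq_mul] at this
  refine Eq.trans ?_ this
  congr 1
  ext i j
  by_cases hi : i ∈ S <;> simp [Finset.piecewise, hi]

variable {q : ℕ}

/-- The matrix `∑ₗ Gₗ Gₗᴴ` with the rows outside `S` replaced by those of the identity; its
determinant is a principal minor. -/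
noncomputable def minorMatrix {n : ℕ} (S : Finset (Fin q)) (G : Fin n → Fin q → ℂ) :
    Matrix (Fin q) (Fin q) ℂ :=
  of fun i j => if i ∈ S then ((of G)ᵀ * ((of G)ᵀ)ᴴ) i j else (1 : Matrix _ _ ℂ) i j

theorem minorMatrix_eq_add_sum_vecMulVec {n : ℕ} (S : Finset (Fin q)) (G : Fin n → Fin q → ℂ) :
    minorMatrix S G = diagonal (fun i => if i ∈ S then 0 else 1) +
        ∑ l, vecMulVec (fun i => if i ∈ S then G l i else 0) (star (G l)) := by
  ext i j
  by_cases hi : i ∈ S <;>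
    simp [minorMatrix, hi, Matrix.sum_apply, vecMulVec_apply, Matrix.mul_apply, Matrix.one_apply,
      diagonal_apply]

theorem integrable_one_mul_ite_mul_star (S : Finset (Fin q)) (i j : Fin q) :
    Integrable (fun x : Fin q → ℂ => (1 : ℂ) * ((if i ∈ S then x i else 0) * star x j))
      (Measure.pi fun _ => stdComplexGaussian) := by
  by_cases hi : i ∈ S
  · simpa [hi] using integrable_pi_mul_star (ι := Fin q) i j
  · simp [hi]

theorem integrable_det_minorMatrix (n : ℕ) (S : Finset (Fin q)) :
    Integrable (fun G : Fin n → Fin q → ℂ => (minorMatrix S G).det)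
      (Measure.pi fun _ => Measure.pi fun _ => stdComplexGaussian) := by
  have h := integrable_prod_mul_det_add_sum_vecMulVec
    (ν := Measure.pi fun _ : Fin q => stdComplexGaussian) (w := fun _ => 1) (integrable_const _) n
    (fun x i => if i ∈ S then x i else 0) (fun x => star x)
    (integrable_one_mul_ite_mul_star S) (diagonal fun i => if i ∈ S then 0 else 1)
  simp only [Finset.prod_const_one, one_mul] at h
  simp only [minorMatrix_eq_add_sum_vecMulVec]
  exact h

/-- A principal minor of order `k` of a complex Wishart matrix with `n` degrees of freedom has mean
`n (n - 1) ⋯ (n - k + 1)`. -/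
theorem integral_det_minorMatrix (n : ℕ) (S : Finset (Fin q)) :
    ∫ G : Fin n → Fin q → ℂ, (minorMatrix S G).det
      ∂(Measure.pi fun _ => Measure.pi fun _ => stdComplexGaussian) =
      (n.descFactorial S.card : ℂ) := by
  have hM : ∀ i j, ∫ x : Fin q → ℂ, (1 : ℂ) * ((if i ∈ S then x i else 0) * star x j)
      ∂(Measure.pi fun _ => stdComplexGaussian) =
      1 * (diagonal (fun i => if i ∈ S then 1 else 0) : Matrix (Fin q) (Fin q) ℂ) i j := by
    intro i j
    by_cases hi : i ∈ S
    · have := integral_diagonal_gaussian_mul (ι := Fin q) (d := 0) (fun _ => le_rfl) i j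
      simpa [hi, diagonal_apply] using this
    · simp [hi, diagonal_apply]
  have h := integral_prod_mul_det_add_sum_vecMulVec
      (ν := Measure.pi fun _ : Fin q => stdComplexGaussian) (w := fun _ => 1)
      (integrable_const (1 : ℂ)) (Z := 1) (by simp)
      (fun x i => if i ∈ S then x i else 0) (fun x => star x)
      (diagonal fun i => if i ∈ S then 1 else 0)
      (integrable_one_mul_ite_mul_star S) hM n (diagonal fun i => if i ∈ S then 0 else 1)
  simp only [Finset.prod_const_one, one_mul, one_pow] at h
  simp only [minorMatrix_eq_add_sum_vecMulVec]
  rw [h, diagonal_map (map_zero C), diagonal_map (map_zero C), ← diagonal_smul, diagonal_add,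
    det_diagonal, ← descCoeffSum_X_pow]
  congr 1
  rw [← Finset.prod_const, ← Finset.prod_subset (Finset.subset_univ S)]
  · exact Finset.prod_congr rfl fun i hi => by simp [hi]
  · intro i _ hi
    simp [hi]

end PrincipalMinors

/-! ### The mean determinant -/

section MeanDeterminant

open Matrix

variable {Ω : Type*} [MeasurableSpace Ω] {μ : Measure Ω}

theorem integrable_prod_betaVal [IsProbabilityMeasure μ] {nd nr : ℕ}
    {H : Ω → Matrix (Fin nd) (Fin nr) ℂ} (hH : IsStdComplexGaussianMatrix H μ) {a : ℝ} (ha : 0 < a)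
    (S : Finset (Fin (min nd nr))) :
    Integrable (fun ω => ∏ i ∈ S, betaVal a (H ω) i) μ := by
  refine Integrable.of_bound (C := a⁻¹ ^ S.card) ?_ (.of_forall fun ω => ?_)
  · exact (S.aemeasurable_fun_prod fun i _ =>
      (measurable_pi_apply i).comp_aemeasurable (hH.aemeasurable_betaVal a)).aestronglyMeasurable
  · rw [norm_prod]
    rw [← Finset.prod_const]
    refine Finset.prod_le_prod (fun i _ => norm_nonneg _) fun i _ => ?_
    rw [Real.norm_of_nonneg (betaVal_nonneg ha _ _)]
    exact betaVal_le ha _ _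

theorem sum_finset_eq_sum_range_card {ι R : Type*} [Fintype ι] [CommSemiring R]
    (f : ℕ → R) (m : Finset ι → R) :
    ∑ S : Finset ι, f S.card * m S = ∑ k ∈ Finset.range (Fintype.card ι + 1),
      f k * ∑ S ∈ Finset.powersetCard k Finset.univ, m S := by
  rw [← Finset.powerset_univ, Finset.sum_powerset, Finset.card_univ]
  refine Finset.sum_congr rfl fun k _ => ?_
  rw [Finset.mul_sum]
  refine Finset.sum_congr rfl fun S hS => ?_
  rw [(Finset.mem_powersetCard.1 hS).2]

/-- Expansion of the determinant in the diagonal entries; the coefficients depend on `H` alone. -/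
theorem det_one_add_smul_conjTranspose_mul_diagonal_mul {q n : ℕ} (c : ℝ) (β : Fin q → ℝ)
    (H : Matrix (Fin q) (Fin n) ℂ) :
    (1 + (c : ℂ) • (Hᴴ * diagonal (fun i => (β i : ℂ)) * H)).det =
      ∑ S : Finset (Fin q), ((∏ i ∈ S, c * β i : ℝ) : ℂ) * (minorMatrix S Hᵀ).det := by
  rw [Matrix.mul_assoc, ← Matrix.mul_smul, det_one_add_mul_comm, ← Matrix.smul_mul,
    Matrix.mul_assoc, ← diagonal_smul, det_one_add_diagonal_mul]
  refine Finset.sum_congr rfl fun S _ => ?_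
  push_cast
  rfl

/-- The mean of `det (1 + c Hᴴ L H)` in terms of the mean elementary symmetric functions of the
diagonal entries of `L`. -/
theorem integrable_and_integral_det_one_add [IsProbabilityMeasure μ] {q n : ℕ}
    {H : Ω → Matrix (Fin q) (Fin n) ℂ} (hH : IsStdComplexGaussianMatrix H μ) {β : Ω → Fin q → ℝ}
    (hint : ∀ S : Finset (Fin q), Integrable (fun ω => ∏ i ∈ S, β ω i) μ)
    (hindep : IndepFun (fun ω (ij : Fin q × Fin n) => H ω ij.1 ij.2) β μ) (c : ℝ) :
    Integrable (fun ω => (1 + (c : ℂ) • ((H ω)ᴴ * diagonal (fun i => (β ω i : ℂ)) * H ω) :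
      Matrix (Fin n) (Fin n) ℂ).det) μ ∧
    ∫ ω, (1 + (c : ℂ) • ((H ω)ᴴ * diagonal (fun i => (β ω i : ℂ)) * H ω) :
      Matrix (Fin n) (Fin n) ℂ).det ∂μ =
      ((∑ k ∈ Finset.range (q + 1), c ^ k * n.descFactorial k *
        ∑ S ∈ Finset.powersetCard k Finset.univ, ∫ ω, ∏ i ∈ S, β ω i ∂μ : ℝ) : ℂ) := by
  simp only [det_one_add_smul_conjTranspose_mul_diagonal_mul]
  -- each term of the expansion is a product of a function of `β` and a function of `H`
  have hind : ∀ S : Finset (Fin q), IndepFun (fun ω => ((∏ i ∈ S, c * β ω i : ℝ) : ℂ))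
      (fun ω => (minorMatrix S (H ω)ᵀ).det) μ := by
    intro S
    refine (hindep.comp (φ := fun h : Fin q × Fin n → ℂ =>
      (minorMatrix S fun l i => h (i, l)).det)
      (ψ := fun b : Fin q → ℝ => ((∏ i ∈ S, c * b i : ℝ) : ℂ)) ?_ ?_).symm
    · simp only [det_apply, minorMatrix, of_apply, Matrix.mul_apply, conjTranspose_apply,
        transpose_apply]
      refine Finset.measurable_fun_sum _ fun σ _ => Measurable.const_smul
        (Finset.measurable_fun_prod _ fun i _ => ?_) _
      split_ifs <;> fun_prop
    · fun_prop
  have hlaw := hH.transpose.hasLaw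
  have h1 : ∀ S : Finset (Fin q), Integrable (fun ω => ((∏ i ∈ S, c * β ω i : ℝ) : ℂ)) μ := by
    intro S
    simp only [Finset.prod_mul_distrib]
    exact ((hint S).const_mul _).ofReal
  have h2 : ∀ S : Finset (Fin q), Integrable (fun ω => (minorMatrix S (H ω)ᵀ).det) μ := by
    intro S
    have h := integrable_det_minorMatrix (q := q) n S
    rw [← hlaw.map_eq] at h
    exact h.comp_aemeasurable hlaw.aemeasurable
  have h3 : ∀ S : Finset (Fin q), ∫ ω, (minorMatrix S (H ω)ᵀ).det ∂μ = n.descFactorial S.card :=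
    fun S => (hlaw.integral_comp (integrable_det_minorMatrix n S).aestronglyMeasurable).trans
      (integral_det_minorMatrix n S)
  have hI : ∀ S : Finset (Fin q), Integrable (fun ω => ((∏ i ∈ S, c * β ω i : ℝ) : ℂ) *
      (minorMatrix S (H ω)ᵀ).det) μ := fun S => (hind S).integrable_mul (h1 S) (h2 S)
  refine ⟨integrable_finsetSum _ fun S _ => hI S, ?_⟩
  rw [integral_finsetSum _ fun S _ => hI S]
  have h4 := sum_finset_eq_sum_range_card (fun k => c ^ k * (n.descFactorial k : ℝ))
    fun S : Finset (Fin q) => ∫ ω, ∏ i ∈ S, β ω i ∂μ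
  rw [Fintype.card_fin] at h4
  rw [← h4, Complex.ofReal_sum]
  refine Finset.sum_congr rfl fun S _ => ?_
  rw [(hind S).integral_fun_mul_eq_mul_integral (h1 S).aestronglyMeasurable
    (h2 S).aestronglyMeasurable, h3, integral_complex_ofReal]
  simp only [Finset.prod_mul_distrib, Finset.prod_const]
  rw [integral_const_mul]
  push_cast
  ring

end MeanDeterminant

theorem mainTheorem3 {Ω : Type*} [MeasurableSpace Ω] (μ : Measure Ω) [IsProbabilityMeasure μ]
    (ns nr nd : ℕ) (hns : 0 < ns) (hnr : 0 < nr) (hnd : 0 < nd)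
    (α ρ a : ℝ) (hα : 0 < α) (hρ : 0 ≤ ρ) (ha : a = α / (nr * (1 + ρ)))
    (H₂ : Ω → Matrix (Fin nd) (Fin nr) ℂ) (hH₂ : IsStdComplexGaussianMatrix H₂ μ)
    (Ht₁ : Ω → Matrix (Fin (min nd nr)) (Fin ns) ℂ) (hHt₁ : IsStdComplexGaussianMatrix Ht₁ μ)
    (hindep : IndepFun (fun ω (ij : Fin (min nd nr) × Fin ns) => Ht₁ ω ij.1 ij.2)
      (fun ω => betaVal a (H₂ ω)) μ) :
    Integrable (fun ω => (1 + ((ρ * a / ns : ℝ) : ℂ) •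
      ((Ht₁ ω)ᴴ * matrixL a (H₂ ω) * Ht₁ ω) : Matrix (Fin ns) (Fin ns) ℂ).det) μ ∧
    ∫ ω, (1 + ((ρ * a / ns : ℝ) : ℂ) •
      ((Ht₁ ω)ᴴ * matrixL a (H₂ ω) * Ht₁ ω) : Matrix (Fin ns) (Fin ns) ℂ).det ∂μ =
      ((constK (max nd nr) (min nd nr) *
        (xiBar (max nd nr) (min nd nr) ns ρ a).det : ℝ) : ℂ) := by
  have ha0 : 0 < a := by rw [ha]; positivity
  obtain ⟨r, hr⟩ : ∃ r, min nd nr = r + 1 := ⟨min nd nr - 1, by omega⟩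
  obtain ⟨d, hd⟩ : ∃ d, max nd nr = d + (r + 1) := ⟨max nd nr - min nd nr, by omega⟩
  obtain ⟨h1, h2⟩ := integrable_and_integral_det_one_add hHt₁
    (integrable_prod_betaVal hH₂ ha0) hindep (ρ * a / ns)
  refine ⟨h1, h2.trans ?_⟩
  congr 1
  -- the mean elementary symmetric functions of the `βᵢ`
  set g : ℕ → ℝ := fun k => ∑ S ∈ Finset.powersetCard k Finset.univ,
    ∫ ω, ∏ i ∈ S, betaVal a (H₂ ω) i ∂μ with hg
  have hrange : Finset.range (min nd nr + 1) = Finset.range (r + 2) := congrArg _ (by rw [hr])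
  have hg0 : g 0 = 1 := by simp [hg]
  have hgx : ∀ x, ∑ k ∈ Finset.range (r + 2), g k * x ^ k = ratioPoly a r (d + r + 1) (a + x) := by
    intro x
    rw [← hH₂.integral_prod_one_add_mul_betaVal ha0 hr (hd.trans (add_assoc d r 1).symm)]
    simp only [Finset.prod_one_add, Finset.prod_mul_distrib, Finset.prod_const]
    rw [integral_finsetSum _ fun S _ => (integrable_prod_betaVal hH₂ ha0 S).const_mul _]
    simp only [integral_const_mul, Finset.powerset_univ]
    rw [sum_finset_eq_sum_range_card (fun k => x ^ k), Fintype.card_fin, hrange]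
    exact Finset.sum_congr rfl fun k _ => mul_comm _ _
  have h3 := constK_mul_det_xiBar ha0 ns ρ hg0 hgx
  rw [← hd, ← hr] at h3
  rw [h3, hrange]
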